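/- **Setting.** Let $(\mathcal D,\wedge,S^0)$ be a closed symmetric monoidal model category (pushout product axiom and unit axiom) with internal homs $Hom$ and with sequential colimits, let $T$ be a cofibrant object of $\mathcal D$ and $\Omega=Hom(T,-)$. Let $Sp(\mathcal D,T)$ be the category of $T$-spectra: sequences $(X_n)_{n\ge 0}$ with structure maps $\sigma_n\colon X_n\wedge T\to X_{n+1}$, whose adjoints are denoted $\tilde\sigma_n\colon X_n\to\Omega X_{n+1}$. Let $Sp^\Sigma(\mathcal D,T)$ be the category of symmetric $T$-spectra: each $X_n$ carries a $\Sigma_n$-action, and the iterated structure maps $X_n\wedge T^{p}\to X_{n+p}$ are $\Sigma_n\times\Sigma_p$-equivariant. *Level equivalences*, *level fibrations* and *level fibrant* spectra are defined levelwise. An *$\Omega$-spectrum* is a level fibrant spectrum all of whose maps $\tilde\sigma_n$ are weak equivalences; a symmetric spectrum is called level fibrant or an $\Omega$-spectrum if its underlying spectrum is. A map $f\colon A\to B$ in $Sp(\mathcal D,T)$ is a *stable equivalence* if $f^*\colon[B,E]\to[A,E]$ is bijective for every $\Omega$-spectrum $E$, where $[-,-]$ denotes morphisms in the localization of $Sp(\mathcal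 D,T)$ at the level equivalences. For a spectrum $X$ let $(\Theta^\infty X)_n$ be the colimit over $l$ of the objects $\Omega^l X_{n+l}$ along the maps $\Omega^l\tilde\sigma_{n+l}$. For a symmetric spectrum $X$ let $\chi_{l,1}\in\Sigma_{l+1}$ be the permutation moving the last letter to the front. Let $(sh X)_n=X_{1+n}$, with $\tau\in\Sigma_n$ acting through $1+\tau$, let $\Omega X$ be given by $(\Omega X)_n=\Omega(X_n)$, and put $R=\Omega\circ sh$. Let $\tilde\lambda_X\colon X\to RX$ be the map with levels $\Omega(\chi_{n,1})\circ\tilde\sigma_n$, let $R^\infty X$ be the colimit of $X\to RX\to R^2X\to\cdots$ along the maps $R^k\tilde\lambda_X$, and let $\lambda^\infty_X\colon X\to R^\infty X$ be the canonical map. For $\tau\in\Sigma_n$ let $\Omega^{\tau}\colon\Omega^n\to\Omega^n$ correspond to $Hom(\tau^{-1},-)$ under $\Omega^n\cong Hom(T^n,-)$, where $\tau$ permutes the factors of $T^n$. The *cycle operator* $d_X\colon(\Theta^\infty X)_0\to(\Theta^\infty X)_0$ is induced by the maps $\Omega^l X_l\xrightarrow{\Omega^l\tilde\sigma_l}\Omega^{l+1}X_{l+1}\xrightarrow{\Omega^{l+1}(\chi_{l,1})\circ\Omega^{\chi_{l,1}}}\Omega^{1+l}X_{1+l}$.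 **Theorem.** Assume that the projective level model structure on $Sp(\mathcal D,T)$ (weak equivalences the level equivalences, fibrations the level fibrations) exists, and that: (a) For every map $f$ in $Sp(\mathcal D,T)$ the following are equivalent: $f$ is a stable equivalence; for every level fibrant replacement $f'$ of $f$ the map $\Theta^\infty f'$ is a level equivalence; there is a level fibrant replacement $f'$ of $f$ such that $\Theta^\infty f'$ is a level equivalence. (A level fibrant replacement of $f\colon A\to B$ is a map $f'\colon A'\to B'$ between level fibrant spectra with level equivalences $a\colon A\to A'$, $b\colon B\to B'$ such that $bf=f'a$.) (b) Countable compositions of stable equivalences in $Sp(\mathcal D,T)$ between level fibrant objects are stable equivalences: if $F_0\to F_1\to\cdots$ is a sequence of stable equivalences between level fibrant spectra, then $F_0\to\operatorname{colim}_kF_k$ is a stable equivalence. (c) $\Omega$ commutes with sequential colimits in $\mathcal D$. (d) Sequential colimits of fibrant objects in $\mathcal D$ are fibrant. Let $X$ be a level fibrant symmetric $T$-spectrum. Then the following are equivalent: 1. There is a map in $Sp^\Sigma(\mathcal D,T)$ from $X$ to an $\Omega$-spectrum which is a stable equivalence in $Sp(\mathcal D,T)$. 2. The map $\tilde\lambda_X\colon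 X\to RX$ is a stable equivalence in $Sp(\mathcal D,T)$. 3. For all $n\ge 0$ the cycle operator $d_{sh^nX}\colon(\Theta^\infty sh^nX)_0\to(\Theta^\infty sh^nX)_0$ is a weak equivalence in $\mathcal D$. 4. The symmetric spectrum $R^\infty X$ is an $\Omega$-spectrum. Moreover, these conditions imply that $\lambda_X^\infty\colon X\to R^\infty X$ is a stable equivalence in $Sp(\mathcal D,T)$. -/

import Mathlib

open CategoryTheory Category MonoidalCategory Limits HomotopicalAlgebra

universe v u

set_option linter.unusedSectionVars false

namespace SymSp

/-! ### Permutations -/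

/-- The permutation `τ + 1` of `n + 1` letters: `τ` on the first `n` letters, the last letter is
fixed. -/
def addOne {n : ℕ} (τ : Equiv.Perm (Fin n)) : Equiv.Perm (Fin (n + 1)) where
  toFun := Fin.lastCases (Fin.last n) (fun i => (τ i).castSucc)
  invFun := Fin.lastCases (Fin.last n) (fun i => (τ.symm i).castSucc)
  left_inv i := by induction i using Fin.lastCases <;> simp
  right_inv i := by induction i using Fin.lastCases <;> simp

/-- The permutation `1 + τ` of `1 + n` letters: the first letter is fixed, `τ` on the last `n`
letters. -/
def oneAdd {n : ℕ} (τ : Equiv.Perm (Fin n)) : Equiv.Perm (Fin (n + 1)) where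
  toFun := Fin.cases 0 (fun i => (τ i).succ)
  invFun := Fin.cases 0 (fun i => (τ.symm i).succ)
  left_inv i := by induction i using Fin.cases <;> simp
  right_inv i := by induction i using Fin.cases <;> simp

/-- The transposition of the last two of `n + 2` letters. -/
def swapLast (n : ℕ) : Equiv.Perm (Fin (n + 2)) :=
  Equiv.swap (Fin.last n).castSucc (Fin.last (n + 1))

/-- The block permutation `χ_{n,1}`, which moves the last of `n + 1` letters to the front:
`i ↦ i + 1` for `i < n` and `n ↦ 0` (letters are numbered from `0`). -/
def chi (n : ℕ) : Equiv.Perm (Fin (n + 1)) := finRotate (n + 1)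

@[simp] lemma addOne_castSucc {n : ℕ} (τ : Equiv.Perm (Fin n)) (i : Fin n) :
    addOne τ i.castSucc = (τ i).castSucc := by simp [addOne]

@[simp] lemma addOne_last {n : ℕ} (τ : Equiv.Perm (Fin n)) :
    addOne τ (Fin.last n) = Fin.last n := by simp [addOne]

@[simp] lemma oneAdd_succ {n : ℕ} (τ : Equiv.Perm (Fin n)) (i : Fin n) :
    oneAdd τ i.succ = (τ i).succ := by simp [oneAdd]

@[simp] lemma oneAdd_zero {n : ℕ} (τ : Equiv.Perm (Fin n)) : oneAdd τ 0 = 0 := by simp [oneAdd]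

@[simp] lemma chi_last (n : ℕ) : chi n (Fin.last n) = 0 := by simp [chi]

@[simp] lemma chi_castSucc (n : ℕ) (i : Fin n) : chi n i.castSucc = i.succ := by
  simp [chi]

lemma addOne_one (n : ℕ) : addOne (1 : Equiv.Perm (Fin n)) = 1 := by
  ext i; induction i using Fin.lastCases <;> simp

lemma addOne_mul {n : ℕ} (τ ρ : Equiv.Perm (Fin n)) :
    addOne (τ * ρ) = addOne τ * addOne ρ := by
  ext i; induction i using Fin.lastCases <;> simp

lemma oneAdd_one (n : ℕ) : oneAdd (1 : Equiv.Perm (Fin n)) = 1 := by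
  ext i; induction i using Fin.cases <;> simp

lemma oneAdd_mul {n : ℕ} (τ ρ : Equiv.Perm (Fin n)) :
    oneAdd (τ * ρ) = oneAdd τ * oneAdd ρ := by
  ext i; induction i using Fin.cases <;> simp

lemma oneAdd_addOne {n : ℕ} (τ : Equiv.Perm (Fin n)) :
    oneAdd (addOne τ) = addOne (oneAdd τ) := by
  ext i
  induction i using Fin.lastCases with
  | last => rw [← Fin.succ_last, oneAdd_succ, addOne_last, Fin.succ_last, addOne_last]
  | cast i =>
    induction i using Fin.cases with
    | zero => rw [addOne_castSucc, Fin.castSucc_zero, oneAdd_zero]; simp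
    | succ i => rw [addOne_castSucc, ← Fin.succ_castSucc, oneAdd_succ]; simp

lemma oneAdd_swapLast (n : ℕ) : oneAdd (swapLast n) = swapLast (n + 1) := by
  ext i
  induction i using Fin.cases with
  | zero =>
    rw [oneAdd_zero, swapLast, Equiv.swap_apply_of_ne_of_ne]
    · simp [Fin.ext_iff]
    · simp [Fin.ext_iff]
  | succ i =>
    rw [oneAdd_succ]
    simp only [swapLast, Equiv.swap_apply_def, Fin.ext_iff]
    split_ifs <;> simp_all

lemma chi_mul_addOne {n : ℕ} (τ : Equiv.Perm (Fin n)) :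
    chi n * addOne τ = oneAdd τ * chi n := by
  ext i; induction i using Fin.lastCases <;> simp

lemma chi_succ (n : ℕ) : chi (n + 1) = addOne (chi n) * swapLast n := by
  ext i
  induction i using Fin.lastCases with
  | last => simp [swapLast]
  | cast i =>
    induction i using Fin.lastCases with
    | last => simp [swapLast, -Fin.succ_last, -Fin.castSucc_inj]
    | cast i =>
      rw [Equiv.Perm.mul_apply, swapLast, Equiv.swap_apply_of_ne_of_ne]
      · simp
      · simp [Fin.ext_iff, i.isLt.ne]
      · simp [Fin.ext_iff]; omega

section

variable {D : Type u} [Category.{v} D] [MonoidalCategory D] [SymmetricCategory D]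

/-! ### The loop functor, tensor powers of `T` and iterated loops -/

/-- The map `A ∧ T ∧ T ⟶ A ∧ T ∧ T` interchanging the two factors `T`. -/
def sw (T A : D) : (A ⊗ T) ⊗ T ⟶ (A ⊗ T) ⊗ T :=
  (α_ A T T).hom ≫ A ◁ (β_ T T).hom ≫ (α_ A T T).inv

/-- The tensor power `T ^ n = T ∧ ... ∧ T`. -/
abbrev tPow (T : D) : ℕ → D
  | 0 => 𝟙_ D
  | n + 1 => tPow T n ⊗ T

/-- The associativity isomorphism `T ∧ T ^ n ≅ T ^ n ∧ T = T ^ (n + 1)`, which keeps the order of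
the factors. -/
def consIso (T : D) : ∀ n : ℕ, T ⊗ tPow T n ≅ tPow T (n + 1)
  | 0 => ρ_ T ≪≫ (λ_ T).symm
  | n + 1 => (α_ T (tPow T n) T).symm ≪≫ whiskerRightIso (consIso T n) T

/-- The permutation `χ_{n,1}` of the factors of `T ^ (n + 1) = T ^ n ∧ T`: it is the block
permutation `T ^ n ∧ T ≅ T ∧ T ^ n`, moving the last factor to the front. -/
def chiT (T : D) (n : ℕ) : tPow T (n + 1) ≅ tPow T (n + 1) :=
  β_ (tPow T n) T ≪≫ consIso T n

lemma sw_sw (T A : D) : sw T A ≫ sw T A = 𝟙 _ := by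
  simp [sw, ← whiskerLeft_comp_assoc]

lemma sw_natural (T : D) {A B : D} (a : A ⟶ B) :
    a ▷ T ▷ T ≫ sw T B = sw T A ≫ a ▷ T ▷ T := by
  simp only [sw, assoc]
  rw [associator_naturality_left_assoc, ← whisker_exchange_assoc,
    associator_inv_naturality_left]

lemma sw_braid (T A : D) :
    sw T A ▷ T ≫ sw T (A ⊗ T) ≫ sw T A ▷ T =
      sw T (A ⊗ T) ≫ sw T A ▷ T ≫ sw T (A ⊗ T) := by
  simp only [sw] 
  calc _ = 𝟙 _ ⊗≫ A ◁ ((β_ T T).hom ▷ T ⊗≫ T ◁ (β_ T T).hom ⊗≫ (β_ T T).hom ▷ T) ⊗≫ 𝟙 _ := by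
        monoidal
    _ = _ := by
      rw [BraidedCategory.yang_baxter']
      monoidal

lemma sw_tensor (T A B : D) {Y : D} (k : ((A ⊗ B) ⊗ T) ⊗ T ⟶ Y) :
    A ◁ sw T B ≫ (α_ A (B ⊗ T) T).inv ≫ (α_ A B T).inv ▷ T ≫ sw T (A ⊗ B) ≫ k =
      (α_ A (B ⊗ T) T).inv ≫ (α_ A B T).inv ▷ T ≫ k := by
  have h : A ◁ sw T B ≫ (α_ A (B ⊗ T) T).inv ≫ (α_ A B T).inv ▷ T =
      (α_ A (B ⊗ T) T).inv ≫ (α_ A B T).inv ▷ T ≫ sw T (A ⊗ B) := by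
    simp only [sw]
    monoidal
  have h' := congrArg (fun m => m ≫ sw T (A ⊗ B) ≫ k) h
  simp only [assoc] at h'
  rw [h', ← assoc (sw T (A ⊗ B)), sw_sw, id_comp]

lemma chiT_zero (T : D) : (chiT T 0).hom = 𝟙 _ := by
  simp [chiT, consIso, tPow]

lemma chiT_succ (T : D) (n : ℕ) :
    (chiT T (n + 1)).hom = sw T (tPow T n) ≫ (chiT T n).hom ▷ T := by
  simp [chiT, consIso, sw, tPow, BraidedCategory.braiding_tensor_left_hom]

lemma chiT_succ_inv (T : D) (n : ℕ) :
    (chiT T (n + 1)).inv = (chiT T n).inv ▷ T ≫ sw T (tPow T n) := by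
  rw [← cancel_epi (chiT T (n + 1)).hom, Iso.hom_inv_id, chiT_succ, assoc,
    ← comp_whiskerRight_assoc, Iso.hom_inv_id, id_whiskerRight, id_comp, sw_sw]

variable [MonoidalClosed D]

/-- The loop functor `Ω = Hom(T, -)`. -/
abbrev Om (T : D) : D ⥤ D := ihom T

/-- The adjunction bijection between maps `A ∧ T ⟶ X` and maps `A ⟶ Ω X`. -/
def adj (T : D) {A X : D} : (A ⊗ T ⟶ X) ≃ (A ⟶ (Om T).obj X) where
  toFun f := MonoidalClosed.curry ((β_ T A).hom ≫ f)
  invFun g := (β_ T A).inv ≫ MonoidalClosed.uncurry g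
  left_inv f := by simp
  right_inv g := by simp

/-- The evaluation `Ω X ∧ T ⟶ X`. -/
def ev (T X : D) : (Om T).obj X ⊗ T ⟶ X := (adj T).symm (𝟙 _)

lemma adj_comp_left (T : D) {A B X : D} (a : A ⟶ B) (f : B ⊗ T ⟶ X) :
    adj T (a ▷ T ≫ f) = a ≫ adj T f := by
  simp [adj, ← MonoidalClosed.curry_natural_left]

lemma adj_comp_right (T : D) {A X Y : D} (f : A ⊗ T ⟶ X) (g : X ⟶ Y) :
    adj T (f ≫ g) = adj T f ≫ (Om T).map g := by
  simp [adj, ← MonoidalClosed.curry_natural_right]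

lemma adj_symm_comp_left (T : D) {A B X : D} (a : A ⟶ B) (g : B ⟶ (Om T).obj X) :
    (adj T).symm (a ≫ g) = a ▷ T ≫ (adj T).symm g := by
  apply (adj T).injective; simp [adj_comp_left]

lemma adj_symm_comp_right (T : D) {A X Y : D} (g : A ⟶ (Om T).obj X) (h : X ⟶ Y) :
    (adj T).symm (g ≫ (Om T).map h) = (adj T).symm g ≫ h := by
  apply (adj T).injective; simp [adj_comp_right]

lemma adj_symm_eq (T : D) {A X : D} (g : A ⟶ (Om T).obj X) :
    (adj T).symm g = g ▷ T ≫ ev T X := by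
  rw [ev, ← adj_symm_comp_left, comp_id]

lemma adj_ev (T : D) {A X : D} (f : A ⊗ T ⟶ X) : adj T f ▷ T ≫ ev T X = f := by
  rw [← adj_symm_eq]; simp

lemma ev_natural (T : D) {X Y : D} (h : X ⟶ Y) :
    (Om T).map h ▷ T ≫ ev T Y = ev T X ≫ h := by
  rw [← adj_symm_eq, ev, ← adj_symm_comp_right, id_comp]

/-- The iterated loop functor `Ω ^ n`. -/
abbrev omPow (T : D) : ℕ → (D ⥤ D)
  | 0 => 𝟭 D
  | n + 1 => Om T ⋙ omPow T n

/-- The iterated adjunction between maps `A ∧ T ^ n ⟶ X` and maps `A ⟶ Ω ^ n X`. The outermost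
loop functor corresponds to the first factor of `T ^ n`. -/
def iterAdj (T : D) : ∀ (n : ℕ) {A X : D}, (A ⊗ tPow T n ⟶ X) ≃ (A ⟶ (omPow T n).obj X)
  | 0, A, _ => (ρ_ A).homFromEquiv
  | n + 1, A, _ =>
    ((α_ A (tPow T n) T).symm.homFromEquiv.trans (adj T)).trans (iterAdj T n)

lemma iterAdj_zero_apply (T : D) {A X : D} (f : A ⊗ tPow T 0 ⟶ X) :
    iterAdj T 0 f = (ρ_ A).inv ≫ f := rfl

lemma iterAdj_succ_apply (T : D) (n : ℕ) {A X : D} (f : A ⊗ tPow T (n + 1) ⟶ X) :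
    iterAdj T (n + 1) f = iterAdj T n (adj T ((α_ A (tPow T n) T).hom ≫ f)) := rfl

lemma iterAdj_comp_left (T : D) (n : ℕ) {A B X : D} (a : A ⟶ B) (f : B ⊗ tPow T n ⟶ X) :
    iterAdj T n (a ▷ tPow T n ≫ f) = a ≫ iterAdj T n f := by
  induction n generalizing A B X with
  | zero => rw [iterAdj_zero_apply, iterAdj_zero_apply]; simp
  | succ n ih =>
    rw [iterAdj_succ_apply, iterAdj_succ_apply, ← ih, ← adj_comp_left]
    simp

lemma iterAdj_comp_right (T : D) (n : ℕ) {A X Y : D} (f : A ⊗ tPow T n ⟶ X) (g : X ⟶ Y) :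
    iterAdj T n (f ≫ g) = iterAdj T n f ≫ (omPow T n).map g := by
  induction n generalizing A X Y with
  | zero => rw [iterAdj_zero_apply, iterAdj_zero_apply]; simp
  | succ n ih =>
    rw [iterAdj_succ_apply, iterAdj_succ_apply, Functor.comp_map, ← ih, ← adj_comp_right, assoc]

/-- The evaluation `ev ^ n : Ω ^ n X ∧ T ^ n ⟶ X`. -/
def iterEv (T : D) (n : ℕ) (X : D) : (omPow T n).obj X ⊗ tPow T n ⟶ X :=
  (iterAdj T n).symm (𝟙 _)

/-- For a self-map `h` of `T ^ n`, the map `Ω ^ n X ⟶ Ω ^ n X` which corresponds to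
`Hom(h, X)` under the isomorphism `Ω ^ n X ≅ Hom(T ^ n, X)`. -/
def omPrecomp (T : D) (n : ℕ) (h : tPow T n ⟶ tPow T n) (X : D) :
    (omPow T n).obj X ⟶ (omPow T n).obj X :=
  iterAdj T n ((omPow T n).obj X ◁ h ≫ iterEv T n X)

lemma iterAdj_omPrecomp (T : D) (n : ℕ) {A X : D} (f : A ⊗ tPow T n ⟶ X)
    (h : tPow T n ⟶ tPow T n) :
    iterAdj T n f ≫ omPrecomp T n h X = iterAdj T n (A ◁ h ≫ f) := by
  rw [omPrecomp, ← iterAdj_comp_left, ← whisker_exchange_assoc]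
  congr 2
  apply (iterAdj T n).injective
  rw [iterAdj_comp_left, iterEv, Equiv.apply_symm_apply, comp_id]

lemma iterAdj_succ (T : D) (n : ℕ) {A X : D} (f : (A ⊗ tPow T n) ⊗ T ⟶ X) :
    iterAdj T n (adj T f) = iterAdj T (n + 1) ((α_ A (tPow T n) T).inv ≫ f) := by
  rw [iterAdj_succ_apply, Iso.hom_inv_id_assoc]

variable (T : D)

/-! ### Spectra -/

/-- A `T`-spectrum: a sequence of objects `X n` with structure maps `X n ∧ T ⟶ X (n + 1)`. -/
structure Spectrum where
  obj : ℕ → D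
  σ (n : ℕ) : obj n ⊗ T ⟶ obj (n + 1)

namespace Spectrum

variable {T}

/-- A morphism of `T`-spectra. -/
@[ext]
structure Hom (X Y : Spectrum T) where
  app (n : ℕ) : X.obj n ⟶ Y.obj n
  comm (n : ℕ) : X.σ n ≫ app (n + 1) = app n ▷ T ≫ Y.σ n

instance : Category (Spectrum T) where
  Hom := Hom
  id X := { app := fun n => 𝟙 _, comm := fun n => by simp }
  comp f g :=
    { app := fun n => f.app n ≫ g.app n
      comm := fun n => by
        rw [← assoc, f.comm, assoc, g.comm, comp_whiskerRight, assoc] }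

@[ext]
lemma hom_ext {X Y : Spectrum T} {f g : X ⟶ Y} (h : ∀ n, f.app n = g.app n) : f = g :=
  Hom.ext (funext h)

@[simp] lemma id_app (X : Spectrum T) (n : ℕ) : Hom.app (𝟙 X) n = 𝟙 (X.obj n) := rfl

@[simp] lemma comp_app {X Y Z : Spectrum T} (f : X ⟶ Y) (g : Y ⟶ Z) (n : ℕ) :
    (f ≫ g).app n = f.app n ≫ g.app n := rfl

/-- The adjoint structure map `X n ⟶ Ω (X (n + 1))`. -/
def adjσ (X : Spectrum T) (n : ℕ) : X.obj n ⟶ (Om T).obj (X.obj (n + 1)) := adj T (X.σ n)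

lemma adjσ_natural {X Y : Spectrum T} (f : X ⟶ Y) (n : ℕ) :
    X.adjσ n ≫ (Om T).map (f.app (n + 1)) = f.app n ≫ Y.adjσ n := by
  rw [adjσ, adjσ, ← adj_comp_right, f.comm, adj_comp_left]

variable (T)

/-- The shift functor `s` on spectra, `(s X) n = X (n + 1)`. -/
def shift : Spectrum T ⥤ Spectrum T where
  obj X := { obj := fun n => X.obj (n + 1), σ := fun n => X.σ (n + 1) }
  map f := { app := fun n => f.app (n + 1), comm := fun n => f.comm (n + 1) }

/-- The iterated shift functor `s ^ n`. -/
def shiftPow : ℕ → (Spectrum T ⥤ Spectrum T)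
  | 0 => 𝟭 _
  | n + 1 => shift T ⋙ shiftPow n

variable {T}

/-- The sequence `X 0 ⟶ Ω (X 1) ⟶ Ω ^ 2 (X 2) ⟶ ...` whose maps are induced by the adjoint
structure maps. -/
def thetaSeq (X : Spectrum T) : ℕ ⥤ D :=
  Functor.ofSequence (X := fun l => (omPow T l).obj (X.obj l))
    (fun l => (omPow T l).map (X.adjσ l))

lemma thetaSeq_map (X : Spectrum T) (l : ℕ) :
    X.thetaSeq.map (homOfLE (Nat.le_add_right l 1)) = (omPow T l).map (X.adjσ l) :=
  Functor.ofSequence_map_homOfLE_succ _ _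

variable (T)

/-- The sequences `thetaSeq X` as a functor of `X`. -/
def thetaSeqFunctor : Spectrum T ⥤ (ℕ ⥤ D) where
  obj X := X.thetaSeq
  map {X Y} f := NatTrans.ofSequence (fun l => (omPow T l).map (f.app l)) (fun l => by
    rw [thetaSeq_map, thetaSeq_map]
    exact ((omPow T l).map_comp _ _).symm.trans
      ((congrArg _ (adjσ_natural f l)).trans ((omPow T l).map_comp _ _)))
  map_id X := by
    ext l
    exact (omPow T l).map_id _
  map_comp f g := by
    ext l
    exact (omPow T l).map_comp _ _

variable [HasColimitsOfShape ℕ D]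

/-- The `0`-th level `(Θ^∞ X) 0` of `Θ^∞ X`, where `Θ = Ω ∘ s`: it is the colimit of
`X 0 ⟶ Ω (X 1) ⟶ Ω ^ 2 (X 2) ⟶ ...`. -/
noncomputable def thetaZero : Spectrum T ⥤ D := thetaSeqFunctor T ⋙ colim

/-- The `n`-th level `(Θ^∞ X) n = (Θ^∞ (s ^ n X)) 0` of `Θ^∞ X`. As colimits of spectra are
computed levelwise, it is the colimit of `X n ⟶ Ω (X (n + 1)) ⟶ Ω ^ 2 (X (n + 2)) ⟶ ...`. -/
noncomputable def theta (n : ℕ) : Spectrum T ⥤ D := shiftPow T n ⋙ thetaZero T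

end Spectrum

/-! ### Symmetric spectra -/

/-- A symmetric `T`-spectrum: a `T`-spectrum with left actions of the symmetric groups `Σ n` on
`X n` such that the iterated structure maps `X n ∧ T ^ p ⟶ X (n + p)` are `Σ n × Σ p`-equivariant.
As symmetric groups are generated by transpositions of neighbours, this needs to be
required only for `p = 1`, and for `p = 2` with the transposition in `Σ 2`; the full equivariance
is proved in `SymSpectrum.iterσ_equivariant` below. -/
structure SymSpectrum extends Spectrum T where
  act {n : ℕ} (τ : Equiv.Perm (Fin n)) : obj n ⟶ obj n
  act_one (n : ℕ) : act (1 : Equiv.Perm (Fin n)) = 𝟙 _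
  act_mul {n : ℕ} (τ ρ : Equiv.Perm (Fin n)) : act (τ * ρ) = act ρ ≫ act τ
  σ_act {n : ℕ} (τ : Equiv.Perm (Fin n)) : act τ ▷ T ≫ σ n = σ n ≫ act (addOne τ)
  σ_swap (n : ℕ) : sw T (obj n) ≫ σ n ▷ T ≫ σ (n + 1) = σ n ▷ T ≫ σ (n + 1) ≫ act (swapLast n)

namespace SymSpectrum

variable {T}

/-- A morphism of symmetric `T`-spectra: a morphism of spectra which is levelwise equivariant. -/
@[ext]
structure Hom (X Y : SymSpectrum T) extends Spectrum.Hom X.toSpectrum Y.toSpectrum where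
  equivariant {n : ℕ} (τ : Equiv.Perm (Fin n)) : X.act τ ≫ app n = app n ≫ Y.act τ

instance : Category (SymSpectrum T) where
  Hom := Hom
  id X := { toHom := 𝟙 X.toSpectrum, equivariant := fun τ => by simp }
  comp {X Y Z} f g :=
    { toHom := (show X.toSpectrum ⟶ Y.toSpectrum from f.toHom) ≫
        (show Y.toSpectrum ⟶ Z.toSpectrum from g.toHom)
      equivariant := fun τ => by
        simp only [Spectrum.comp_app]
        rw [← assoc, f.equivariant, assoc, g.equivariant, assoc] }

@[ext]
lemma hom_ext {X Y : SymSpectrum T} {f g : X ⟶ Y} (h : ∀ n, f.app n = g.app n) : f = g :=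
  Hom.ext (funext h)

@[simp] lemma id_app (X : SymSpectrum T) (n : ℕ) :
    Spectrum.Hom.app (Hom.toHom (𝟙 X)) n = 𝟙 (X.obj n) := rfl

@[simp] lemma comp_app {X Y Z : SymSpectrum T} (f : X ⟶ Y) (g : Y ⟶ Z) (n : ℕ) :
    (f ≫ g).app n = f.app n ≫ g.app n := rfl

variable (T) in
/-- The forgetful functor from symmetric spectra to spectra. -/
def forget : SymSpectrum T ⥤ Spectrum T where
  obj X := X.toSpectrum
  map f := f.toHom

end SymSpectrum

/-! The equivariance of the iterated structure maps of a symmetric spectrum. -/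

/-- The permutation `ρ + τ` of `n + p` letters. -/
def blockAdd {n p : ℕ} (ρ : Equiv.Perm (Fin n)) (τ : Equiv.Perm (Fin p)) :
    Equiv.Perm (Fin (n + p)) :=
  finSumFinEquiv.permCongr (Equiv.sumCongr ρ τ)

lemma blockAdd_castAdd {n p : ℕ} (ρ : Equiv.Perm (Fin n)) (τ : Equiv.Perm (Fin p)) (i : Fin n) :
    blockAdd ρ τ (Fin.castAdd p i) = Fin.castAdd p (ρ i) := by
  simp [blockAdd, Equiv.permCongr_apply]

lemma blockAdd_natAdd {n p : ℕ} (ρ : Equiv.Perm (Fin n)) (τ : Equiv.Perm (Fin p)) (i : Fin p) :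
    blockAdd ρ τ (Fin.natAdd n i) = Fin.natAdd n (τ i) := by
  simp [blockAdd, Equiv.permCongr_apply]

lemma blockAdd_mul {n p : ℕ} (ρ ρ' : Equiv.Perm (Fin n)) (τ τ' : Equiv.Perm (Fin p)) :
    blockAdd (ρ * ρ') (τ * τ') = blockAdd ρ τ * blockAdd ρ' τ' := by
  ext i
  induction i using Fin.addCases <;>
    simp [blockAdd_castAdd, blockAdd_natAdd, -Fin.natAdd_eq_addNat]

lemma blockAdd_one (n p : ℕ) :
    blockAdd (1 : Equiv.Perm (Fin n)) (1 : Equiv.Perm (Fin p)) = 1 := by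
  ext i
  induction i using Fin.addCases <;>
    simp [blockAdd_castAdd, blockAdd_natAdd, -Fin.natAdd_eq_addNat]

lemma blockAdd_zero {n : ℕ} (ρ : Equiv.Perm (Fin n)) (τ : Equiv.Perm (Fin 0)) :
    blockAdd ρ τ = ρ := by
  ext i
  exact congrArg Fin.val (blockAdd_castAdd ρ τ i)

lemma blockAdd_addOne {n p : ℕ} (ρ : Equiv.Perm (Fin n)) (τ : Equiv.Perm (Fin p)) :
    blockAdd ρ (addOne τ) = addOne (blockAdd ρ τ) := by
  refine Equiv.ext fun i => ?_
  induction i using Fin.lastCases with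
  | last =>
    refine (blockAdd_natAdd ρ (addOne τ) (Fin.last p)).trans ?_
    rw [addOne_last]
    exact (addOne_last _).symm
  | cast i =>
    rw [addOne_castSucc]
    induction i using Fin.addCases with
    | left i =>
      rw [blockAdd_castAdd]
      exact blockAdd_castAdd ρ (addOne τ) i
    | right i =>
      rw [blockAdd_natAdd]
      refine (blockAdd_natAdd ρ (addOne τ) i.castSucc).trans ?_
      rw [addOne_castSucc]
      rfl

lemma blockAdd_swapLast (n p : ℕ) :
    blockAdd (1 : Equiv.Perm (Fin n)) (swapLast p) = swapLast (n + p) := by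
  refine Equiv.ext fun i => ?_
  induction i using Fin.addCases with
  | left i =>
    rw [blockAdd_castAdd]
    symm
    apply Equiv.swap_apply_of_ne_of_ne <;> simp [Fin.ext_iff] <;> omega
  | right i =>
    rw [blockAdd_natAdd]
    simp only [swapLast, Equiv.swap_apply_def, Fin.ext_iff]
    split_ifs <;> simp_all <;> omega

/-- `IsPermMap T τ f` means that the map `f : T ^ p ⟶ T ^ p` is the permutation of the factors of
`T ^ p` given by `τ`; the permutations are generated by transpositions of neighbours. -/
inductive IsPermMap (T : D) : ∀ {p : ℕ}, Equiv.Perm (Fin p) → (tPow T p ⟶ tPow T p) → Prop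
  | one (p : ℕ) : IsPermMap T (1 : Equiv.Perm (Fin p)) (𝟙 _)
  | mul {p : ℕ} {τ ρ : Equiv.Perm (Fin p)} {f g : tPow T p ⟶ tPow T p} :
      IsPermMap T τ f → IsPermMap T ρ g → IsPermMap T (τ * ρ) (g ≫ f)
  | addOne {p : ℕ} {τ : Equiv.Perm (Fin p)} {f : tPow T p ⟶ tPow T p} :
      IsPermMap T τ f → IsPermMap T (p := p + 1) (addOne τ) (f ▷ T)
  | swapLast (p : ℕ) : IsPermMap T (p := p + 2) (swapLast p) (sw T (tPow T p))

lemma IsPermMap.exists_swap (T : D) {p : ℕ} (i : Fin p) :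
    ∃ f, IsPermMap T (p := p + 1) (Equiv.swap i.castSucc i.succ) f := by
  induction p with
  | zero => exact i.elim0
  | succ p ih =>
    induction i using Fin.lastCases with
    | last => exact ⟨_, IsPermMap.swapLast p⟩
    | cast i =>
      obtain ⟨f, hf⟩ := ih i
      have h : Equiv.swap i.castSucc.castSucc i.castSucc.succ =
          SymSp.addOne (Equiv.swap i.castSucc i.succ) := by
        refine Equiv.ext fun j => ?_
        induction j using Fin.lastCases with
        | last =>
          rw [addOne_last]
          apply Equiv.swap_apply_of_ne_of_ne <;> simp [Fin.ext_iff] <;> omega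
        | cast j =>
          rw [addOne_castSucc]
          simp only [Equiv.swap_apply_def, Fin.ext_iff]
          split_ifs <;> simp_all
      rw [h]
      exact ⟨_, hf.addOne⟩

/-- Every permutation acts on `T ^ p`. -/
lemma IsPermMap.exists (T : D) {p : ℕ} (τ : Equiv.Perm (Fin p)) : ∃ f, IsPermMap T τ f := by
  cases p with
  | zero =>
    obtain rfl : τ = 1 := Subsingleton.elim _ _
    exact ⟨_, IsPermMap.one 0⟩
  | succ p =>
    have h : τ ∈ Submonoid.closure
        (Set.range fun i : Fin p => Equiv.swap i.castSucc i.succ) := by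
      rw [Equiv.Perm.mclosure_swap_castSucc_succ]
      trivial
    induction h using Submonoid.closure_induction with
    | mem x hx =>
      obtain ⟨i, rfl⟩ := hx
      exact IsPermMap.exists_swap T i
    | one => exact ⟨_, IsPermMap.one _⟩
    | mul x y _ _ hx hy =>
      obtain ⟨f, hf⟩ := hx
      obtain ⟨g, hg⟩ := hy
      exact ⟨_, hf.mul hg⟩

namespace SymSpectrum

/-- The iterated structure maps `X n ∧ T ^ p ⟶ X (n + p)`. -/
def iterσ {T : D} (X : SymSpectrum T) (n : ℕ) : ∀ p : ℕ, X.obj n ⊗ tPow T p ⟶ X.obj (n + p)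
  | 0 => (ρ_ _).hom
  | p + 1 => (α_ (X.obj n) (tPow T p) T).inv ≫ iterσ X n p ▷ T ≫ X.σ (n + p)

lemma iterσ_succ {T : D} (X : SymSpectrum T) (n p : ℕ) :
    X.iterσ n (p + 1) = (α_ (X.obj n) (tPow T p) T).inv ≫ X.iterσ n p ▷ T ≫ X.σ (n + p) := rfl

/-- The iterated structure maps `X n ∧ T ^ p ⟶ X (n + p)` are `Σ n × Σ p`-equivariant. -/
theorem iterσ_equivariant {T : D} (X : SymSpectrum T) {n p : ℕ} (ρ : Equiv.Perm (Fin n))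
    {τ : Equiv.Perm (Fin p)} {f : tPow T p ⟶ tPow T p} (h : IsPermMap T τ f) :
    X.act ρ ▷ tPow T p ≫ X.obj n ◁ f ≫ X.iterσ n p = X.iterσ n p ≫ X.act (blockAdd ρ τ) := by
  have h1 : X.obj n ◁ f ≫ X.iterσ n p = X.iterσ n p ≫ X.act (blockAdd 1 τ) := by
    induction h with
    | one p => rw [blockAdd_one, X.act_one]; simp
    | @mul p τ ρ f g _ _ hf hg =>
      rw [← one_mul (1 : Equiv.Perm (Fin n)), blockAdd_mul, X.act_mul, whiskerLeft_comp, assoc, hf,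
        ← assoc, hg, assoc]
    | @addOne p τ f _ hf =>
      rw [blockAdd_addOne, iterσ_succ, assoc, assoc, ← X.σ_act, ← comp_whiskerRight_assoc, ← hf]
      simp
    | swapLast p =>
      rw [blockAdd_swapLast, iterσ_succ, iterσ_succ]
      simp only [comp_whiskerRight, assoc]
      have hs : X.σ (n + p) ▷ T ≫ X.σ (n + (p + 1)) ≫ X.act (SymSp.swapLast (n + p)) =
          sw T _ ≫ X.σ (n + p) ▷ T ≫ X.σ (n + (p + 1)) := (X.σ_swap (n + p)).symm
      have hn := congrArg (fun k => k ≫ X.σ (n + p) ▷ T ≫ X.σ (n + (p + 1)))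
        (sw_natural T (X.iterσ n p))
      have ht := sw_tensor T (X.obj n) (tPow T p)
        (sw T _ ≫ X.iterσ n p ▷ T ▷ T ≫ X.σ (n + p) ▷ T ≫ X.σ (n + (p + 1)))
      have hss := congrArg
        (fun k => k ≫ X.iterσ n p ▷ T ▷ T ≫ X.σ (n + p) ▷ T ≫ X.σ (n + (p + 1)))
        (sw_sw T (X.obj n ⊗ tPow T p))
      simp only [assoc, id_comp] at hn hss
      rw [hss] at ht
      rw [hs, hn]
      exact ht
  have h2 : X.act ρ ▷ tPow T p ≫ X.iterσ n p = X.iterσ n p ≫ X.act (blockAdd ρ 1) := by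
    clear h h1 f τ
    induction p with
    | zero => rw [blockAdd_zero]; simp [iterσ]
    | succ p ih =>
      rw [← addOne_one, blockAdd_addOne, iterσ_succ, assoc, assoc, ← X.σ_act,
        ← comp_whiskerRight_assoc, ← ih]
      simp
  rw [h1, ← assoc, h2, assoc, ← X.act_mul, ← blockAdd_mul, one_mul, mul_one]

end SymSpectrum

namespace SymSpectrum

variable {T}

/-- The shift functor `sh` on symmetric spectra: `(sh X) n = X (1 + n)`, on which `Σ n` acts through
the permutations `1 + τ`. -/
def sh : SymSpectrum T ⥤ SymSpectrum T where
  obj X :=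
    { toSpectrum := (Spectrum.shift T).obj X.toSpectrum
      act := fun τ => X.act (oneAdd τ)
      act_one := fun n => by rw [oneAdd_one]; exact X.act_one _
      act_mul := fun τ ρ => by rw [oneAdd_mul]; exact X.act_mul _ _
      σ_act := fun τ => by rw [oneAdd_addOne]; exact X.σ_act _
      σ_swap := fun n => by rw [oneAdd_swapLast]; exact X.σ_swap _ }
  map f :=
    { toHom := (Spectrum.shift T).map f.toHom
      equivariant := fun τ => f.equivariant (oneAdd τ) }

variable (T) in
/-- The iterated shift functor `sh ^ n`. -/
def shPow : ℕ → (SymSpectrum T ⥤ SymSpectrum T)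
  | 0 => 𝟭 _
  | n + 1 => sh ⋙ shPow n

/-- The structure map of `Ω X`, for a structure map `f : A ∧ T ⟶ B` of `X`: the adjoint of
`Ω A ∧ T ∧ T ⟶ Ω A ∧ T ∧ T ⟶ A ∧ T ⟶ B`, where the first map interchanges the factors `T`
and the second one is given by the evaluation `Ω A ∧ T ⟶ A`. -/
def omσ {A B : D} (f : A ⊗ T ⟶ B) : (Om T).obj A ⊗ T ⟶ (Om T).obj B :=
  adj T (sw T _ ≫ ev T A ▷ T ≫ f)

lemma omσ_ev {A B C : D} (f : A ⊗ T ⟶ B) (k : B ⟶ C) :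
    omσ f ▷ T ≫ ev T B ≫ k = sw T _ ≫ ev T A ▷ T ≫ f ≫ k := by
  rw [← assoc, omσ, adj_ev, assoc, assoc]

lemma hom_Om_ext {A X : D} {f g : A ⟶ (Om T).obj X} (h : f ▷ T ≫ ev T X = g ▷ T ≫ ev T X) :
    f = g := by
  rw [← adj_symm_eq, ← adj_symm_eq] at h
  exact (adj T).symm.injective h

lemma omσ_natural {A B A' B' : D} {f : A ⊗ T ⟶ B} {f' : A' ⊗ T ⟶ B'} {a : A ⟶ A'} {b : B ⟶ B'}
    (h : f ≫ b = a ▷ T ≫ f') :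
    omσ f ≫ (Om T).map b = (Om T).map a ▷ T ≫ omσ f' := by
  apply hom_Om_ext
  have e := omσ_ev f' (𝟙 _)
  simp only [comp_id] at e
  rw [comp_whiskerRight, assoc, ev_natural, omσ_ev, comp_whiskerRight, assoc, e,
    ← assoc ((Om T).map a ▷ T ▷ T), sw_natural, assoc, ← comp_whiskerRight_assoc, ev_natural,
    comp_whiskerRight_assoc, h]

lemma omσ_omσ {A B C E : D} (f : A ⊗ T ⟶ B) (g : B ⊗ T ⟶ C) (k : C ⟶ E) :
    omσ f ▷ T ▷ T ≫ omσ g ▷ T ≫ ev T C ≫ k =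
      sw T _ ≫ sw T _ ▷ T ≫ ev T A ▷ T ▷ T ≫ f ▷ T ≫ g ≫ k := by
  have e := omσ_ev f (𝟙 _)
  simp only [comp_id] at e
  rw [omσ_ev, ← assoc, sw_natural, assoc, ← comp_whiskerRight_assoc, e]
  simp only [comp_whiskerRight, assoc]

lemma omσ_swap {A B C : D} {f : A ⊗ T ⟶ B} {g : B ⊗ T ⟶ C} {t : C ⟶ C}
    (h : sw T A ≫ f ▷ T ≫ g = f ▷ T ≫ g ≫ t) :
    sw T _ ≫ omσ f ▷ T ≫ omσ g = omσ f ▷ T ≫ omσ g ≫ (Om T).map t := by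
  apply hom_Om_ext
  have e := omσ_omσ f g (𝟙 _)
  simp only [comp_id] at e
  have b := congrArg (fun k => k ≫ ev T A ▷ T ▷ T ≫ f ▷ T ≫ g) (sw_braid T ((Om T).obj A))
  simp only [assoc] at b
  simp only [comp_whiskerRight, assoc]
  rw [e, ev_natural, omσ_omσ, b, ← h, ← assoc (sw T ((Om T).obj A ⊗ T)) (ev T A ▷ T ▷ T),
    ← sw_natural, assoc]

/-- The loop functor `Ω` on symmetric spectra, levelwise given by `Ω = Hom(T, -)`. -/
def omega : SymSpectrum T ⥤ SymSpectrum T where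
  obj X :=
    { obj := fun n => (Om T).obj (X.obj n)
      σ := fun n => omσ (X.σ n)
      act := fun τ => (Om T).map (X.act τ)
      act_one := fun n => by rw [X.act_one]; exact (Om T).map_id _
      act_mul := fun τ ρ => by rw [X.act_mul]; exact (Om T).map_comp _ _
      σ_act := fun τ => (omσ_natural (X.σ_act τ).symm).symm
      σ_swap := fun n => omσ_swap (X.σ_swap n) }
  map f :=
    { app := fun n => (Om T).map (f.app n)
      comm := fun n => omσ_natural (f.comm n)
      equivariant := fun τ => by
        rw [← Functor.map_comp, f.equivariant]; exact (Om T).map_comp _ _ }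
  map_id X := by ext n; exact (Om T).map_id _
  map_comp f g := by ext n; exact (Om T).map_comp _ _

variable (T) in
/-- The functor `R = Ω ∘ sh`. -/
def R : SymSpectrum T ⥤ SymSpectrum T := sh ⋙ omega

/-- The `n`-th level of `λ̃_X`: the composition of the adjoint structure map `X n ⟶ Ω (X (n + 1))`
and of `Ω` applied to the action of `χ_{n,1}`. -/
def lamTApp (X : SymSpectrum T) (n : ℕ) : X.obj n ⟶ (Om T).obj (X.obj (n + 1)) :=
  X.adjσ n ≫ (Om T).map (X.act (chi n))

lemma lamTApp_ev (X : SymSpectrum T) (n : ℕ) :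
    lamTApp X n ▷ T ≫ ev T _ = X.σ n ≫ X.act (chi n) := by
  rw [lamTApp, comp_whiskerRight, assoc, ev_natural, ← assoc, Spectrum.adjσ, adj_ev]

lemma lamTApp_comm (X : SymSpectrum T) (n : ℕ) :
    X.σ n ≫ lamTApp X (n + 1) = lamTApp X n ▷ T ≫ omσ (X.σ (n + 1)) := by
  apply hom_Om_ext
  have e := omσ_ev (X.σ (n + 1)) (𝟙 _)
  simp only [comp_id] at e
  rw [comp_whiskerRight, assoc, lamTApp_ev, comp_whiskerRight, assoc, e,
    ← assoc (lamTApp X n ▷ T ▷ T), sw_natural, assoc, ← comp_whiskerRight_assoc, lamTApp_ev,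
    comp_whiskerRight_assoc, X.σ_act, chi_succ, X.act_mul]
  have h := congrArg (fun k => k ≫ X.act (addOne (chi n))) (X.σ_swap n)
  simp only [assoc] at h
  rw [h]

lemma lamTApp_equivariant (X : SymSpectrum T) {n : ℕ} (τ : Equiv.Perm (Fin n)) :
    X.act τ ≫ lamTApp X n = lamTApp X n ≫ (Om T).map (X.act (oneAdd τ)) := by
  apply hom_Om_ext
  rw [comp_whiskerRight, assoc, lamTApp_ev, comp_whiskerRight, assoc, ev_natural, ← assoc,
    X.σ_act, ← assoc (lamTApp X n ▷ T), lamTApp_ev, assoc, assoc, ← X.act_mul, ← X.act_mul,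
    chi_mul_addOne]

/-- The natural map `λ̃_X : X ⟶ R X = Ω (sh X)`. -/
def lamT (X : SymSpectrum T) : X ⟶ (R T).obj X where
  app n := lamTApp X n
  comm n := lamTApp_comm X n
  equivariant τ := lamTApp_equivariant X τ

variable (T) in
/-- The iterates `R ^ n`. -/
def RPow : ℕ → (SymSpectrum T ⥤ SymSpectrum T)
  | 0 => 𝟭 _
  | n + 1 => R T ⋙ RPow n

/-- The sequence `X ⟶ R X ⟶ R ^ 2 X ⟶ ...` with the maps `R ^ k (λ̃_X)`. -/
def RSeq (X : SymSpectrum T) : ℕ ⥤ SymSpectrum T :=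
  Functor.ofSequence (X := fun k => (RPow T k).obj X) (fun k => (RPow T k).map (lamT X))

/-! ### Colimits of symmetric spectra -/

section Colimits

variable {J : Type*} [Category J] [HasColimitsOfShape J D] (F : J ⥤ SymSpectrum T)

variable (T) in
/-- The evaluation of symmetric spectra at level `n`. -/
def eval (n : ℕ) : SymSpectrum T ⥤ D where
  obj X := X.obj n
  map f := f.app n

/-- The inclusions into the levels of the colimit of symmetric spectra. -/
noncomputable abbrev lι (n : ℕ) (j : J) : (F.obj j).obj n ⟶ colimit (F ⋙ eval T n) :=
  colimit.ι (F ⋙ eval T n) j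

lemma lι_w (n : ℕ) {i j : J} (f : i ⟶ j) : (F.map f).app n ≫ lι F n j = lι F n i :=
  colimit.w (F ⋙ eval T n) f

lemma whisker_ext {n : ℕ} {Y : D} {f g : colimit (F ⋙ eval T n) ⊗ T ⟶ Y}
    (h : ∀ j, lι F n j ▷ T ≫ f = lι F n j ▷ T ≫ g) : f = g := by
  apply (adj T).injective
  refine colimit.hom_ext fun j => ?_
  exact (adj_comp_left T _ f).symm.trans ((congrArg _ (h j)).trans (adj_comp_left T _ g))

lemma whisker_whisker_ext {n : ℕ} {Y : D} {f g : (colimit (F ⋙ eval T n) ⊗ T) ⊗ T ⟶ Y}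
    (h : ∀ j, lι F n j ▷ T ▷ T ≫ f = lι F n j ▷ T ▷ T ≫ g) : f = g := by
  apply (adj T).injective
  refine whisker_ext F fun j => ?_
  rw [← adj_comp_left, h j, adj_comp_left]

lemma σ_lι_w (n : ℕ) {i j : J} (f : i ⟶ j) :
    (F.map f).app n ▷ T ≫ (F.obj j).σ n ≫ lι F (n + 1) j = (F.obj i).σ n ≫ lι F (n + 1) i := by
  rw [← lι_w F (n + 1) f, ← assoc, ← assoc, (F.map f).comm]

/-- The structure maps of the colimit. -/
noncomputable def colimσ (n : ℕ) :
    colimit (F ⋙ eval T n) ⊗ T ⟶ colimit (F ⋙ eval T (n + 1)) :=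
  (adj T).symm (colimit.desc (F ⋙ eval T n)
    { pt := (Om T).obj (colimit (F ⋙ eval T (n + 1)))
      ι :=
        { app := fun j => adj T ((F.obj j).σ n ≫ lι F (n + 1) j)
          naturality := fun i j f => by
            refine Eq.trans ?_ (comp_id _).symm
            refine (adj_comp_left T ((F.map f).app n) _).symm.trans ?_
            exact congrArg (adj T) (σ_lι_w F n f) } })

lemma lι_colimσ (n : ℕ) (j : J) :
    lι F n j ▷ T ≫ colimσ F n = (F.obj j).σ n ≫ lι F (n + 1) j := by
  rw [colimσ, ← adj_symm_comp_left]
  exact (congrArg (adj T).symm (colimit.ι_desc _ j)).trans (Equiv.symm_apply_apply _ _)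

/-- The action of permutations on the levels of the colimit. -/
noncomputable def colimAct {n : ℕ} (τ : Equiv.Perm (Fin n)) :
    colimit (F ⋙ eval T n) ⟶ colimit (F ⋙ eval T n) :=
  colimMap
    { app := fun j => (F.obj j).act τ
      naturality := fun _ _ f => ((F.map f).equivariant τ).symm }

lemma lι_colimAct {n : ℕ} (τ : Equiv.Perm (Fin n)) (j : J) :
    lι F n j ≫ colimAct F τ = (F.obj j).act τ ≫ lι F n j :=
  ι_colimMap _ _

/-- The colimit of a diagram of symmetric spectra, formed levelwise. -/
noncomputable def colimObj : SymSpectrum T where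
  obj n := colimit (F ⋙ eval T n)
  σ := colimσ F
  act := colimAct F
  act_one n := colimit.hom_ext fun j => by
    refine (lι_colimAct F _ j).trans ?_
    rw [act_one, id_comp, comp_id]
  act_mul τ ρ := colimit.hom_ext fun j => by
    refine (lι_colimAct F _ j).trans ?_
    rw [act_mul, assoc, ← lι_colimAct, ← assoc, ← lι_colimAct, assoc]
    rfl
  σ_act τ := whisker_ext F fun j => by
    rw [← comp_whiskerRight_assoc, lι_colimAct, comp_whiskerRight_assoc, lι_colimσ, ← assoc,
      σ_act, assoc, ← assoc (lι F _ j ▷ T), lι_colimσ, assoc, lι_colimAct]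
  σ_swap n := whisker_whisker_ext F fun j => by
    rw [← assoc, sw_natural, assoc, ← comp_whiskerRight_assoc, lι_colimσ,
      comp_whiskerRight_assoc, lι_colimσ, ← assoc (_ ▷ T), ← assoc (sw T _), (F.obj j).σ_swap,
      ← comp_whiskerRight_assoc, lι_colimσ, comp_whiskerRight_assoc, ← assoc (lι F _ j ▷ T),
      lι_colimσ, assoc, assoc, assoc, lι_colimAct]

/-- The colimit cocone of a diagram of symmetric spectra. -/
noncomputable def colimCocone : Cocone F where
  pt := colimObj F
  ι :=
    { app := fun j =>
        { app := fun n => lι F n j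
          comm := fun n => (lι_colimσ F n j).symm
          equivariant := fun τ => (lι_colimAct F τ j).symm }
      naturality := fun i j f => by
        ext n
        exact (lι_w F n f).trans (comp_id _).symm }

/-- The levels of the map from the colimit to the point of a cocone. -/
noncomputable def colimDesc (s : Cocone F) (n : ℕ) :
    colimit (F ⋙ eval T n) ⟶ s.pt.obj n :=
  colimit.desc (F ⋙ eval T n) ((eval T n).mapCocone s)

lemma lι_colimDesc (s : Cocone F) (n : ℕ) (j : J) :
    lι F n j ≫ colimDesc F s n = (s.ι.app j).app n :=
  colimit.ι_desc ((eval T n).mapCocone s) j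

lemma colimDesc_comm (s : Cocone F) (n : ℕ) :
    colimσ F n ≫ colimDesc F s (n + 1) = colimDesc F s n ▷ T ≫ s.pt.σ n :=
  whisker_ext F fun j => by
    rw [← assoc, lι_colimσ, assoc, lι_colimDesc, ← comp_whiskerRight_assoc, lι_colimDesc]
    exact (s.ι.app j).comm n

lemma colimDesc_equivariant (s : Cocone F) {n : ℕ} (τ : Equiv.Perm (Fin n)) :
    colimAct F τ ≫ colimDesc F s n = colimDesc F s n ≫ s.pt.act τ :=
  colimit.hom_ext fun j => by
    refine (assoc _ _ _).symm.trans (Eq.trans ?_ (assoc _ _ _))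
    refine (congrArg (fun k => k ≫ _) (lι_colimAct F τ j)).trans
      (Eq.trans ?_ (congrArg (fun k => k ≫ _) (lι_colimDesc F s n j).symm))
    rw [assoc, lι_colimDesc]
    exact (s.ι.app j).equivariant τ

/-- The levelwise cocone is a colimit. -/
noncomputable def colimCoconeIsColimit : IsColimit (colimCocone F) where
  desc s :=
    { app := fun n => colimDesc F s n
      comm := fun n => colimDesc_comm F s n
      equivariant := fun τ => colimDesc_equivariant F s τ }
  fac s j := by
    ext n
    exact colimit.ι_desc ((eval T n).mapCocone s) j
  uniq s m h := by
    ext n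
    refine colimit.hom_ext fun j => ?_
    refine Eq.trans ?_ (colimit.ι_desc ((eval T n).mapCocone s) j).symm
    exact congrArg (fun k => Spectrum.Hom.app (Hom.toHom k) n) (h j)

instance : HasColimitsOfShape J (SymSpectrum T) where
  has_colimit F := ⟨⟨⟨colimCocone F, colimCoconeIsColimit F⟩⟩⟩

end Colimits

variable [HasColimitsOfShape ℕ D]

/-- The symmetric spectrum `R^∞ X`, the colimit of `X ⟶ R X ⟶ R ^ 2 X ⟶ ...`. -/
noncomputable def RInfty (X : SymSpectrum T) : SymSpectrum T := colimit X.RSeq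

/-- The canonical map `λ^∞_X : X ⟶ R^∞ X`. -/
noncomputable def lamInfty (X : SymSpectrum T) : X ⟶ X.RInfty := colimit.ι X.RSeq 0

/-! ### The cycle operator -/

/-- The `l`-th component of the cycle operator: the composition
`Ω ^ l (X l) ⟶ Ω ^ (l + 1) (X (l + 1)) ⟶ Ω ^ (1 + l) (X (1 + l))`
of the map induced by the adjoint structure map and of the action of `χ_{l,1}` by conjugation, that
is by `χ_{l,1}` on `X (l + 1)` and by precomposition with the inverse of `χ_{l,1}` on
`T ^ (l + 1)`. -/
def cycleApp (X : SymSpectrum T) (l : ℕ) :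
    (omPow T l).obj (X.obj l) ⟶ (omPow T (l + 1)).obj (X.obj (l + 1)) :=
  (omPow T l).map (X.adjσ l) ≫ omPrecomp T (l + 1) (chiT T l).inv (X.obj (l + 1)) ≫
    (omPow T (l + 1)).map (X.act (chi l))

lemma iterAdj_adjσ (X : SymSpectrum T) (l : ℕ) {A : D} (f : A ⊗ tPow T l ⟶ X.obj l) :
    iterAdj T l f ≫ (omPow T l).map (X.adjσ l) =
      iterAdj T (l + 1) ((α_ A (tPow T l) T).inv ≫ f ▷ T ≫ X.σ l) := by
  rw [← iterAdj_comp_right, Spectrum.adjσ, ← adj_comp_left, iterAdj_succ]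

lemma iterAdj_cycleApp (X : SymSpectrum T) (l : ℕ) {A : D} (f : A ⊗ tPow T l ⟶ X.obj l) :
    iterAdj T l f ≫ cycleApp X l =
      iterAdj T (l + 1) (A ◁ (chiT T l).inv ≫ (α_ A (tPow T l) T).inv ≫ f ▷ T ≫ X.σ l ≫
        X.act (chi l)) := by
  rw [cycleApp, ← assoc, iterAdj_adjσ, ← assoc, iterAdj_omPrecomp, ← iterAdj_comp_right]
  simp only [assoc]

lemma cycleApp_comm (X : SymSpectrum T) (l : ℕ) :
    (omPow T l).map (X.adjσ l) ≫ cycleApp X (l + 1) =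
      cycleApp X l ≫ (omPow T (l + 1)).map (X.adjσ (l + 1)) := by
  obtain ⟨f, hf⟩ := (iterAdj T l).surjective (𝟙 ((omPow T l).obj (X.obj l)))
  have h : iterAdj T l f ≫ (omPow T l).map (X.adjσ l) ≫ cycleApp X (l + 1) =
      iterAdj T l f ≫ cycleApp X l ≫ (omPow T (l + 1)).map (X.adjσ (l + 1)) := by
    rw [← assoc, iterAdj_adjσ, iterAdj_cycleApp, ← assoc (iterAdj T l f), iterAdj_cycleApp,
      iterAdj_adjσ]
    congr 1
    rw [chiT_succ_inv, chi_succ, X.act_mul]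
    have h := congrArg (fun k => k ≫ X.act (addOne (chi l))) (X.σ_swap l)
    simp only [assoc] at h
    simp only [comp_whiskerRight, assoc, X.σ_act]
    rw [← h, ← assoc (f ▷ T ▷ T), sw_natural, whiskerLeft_comp, assoc, assoc, sw_tensor]
    monoidal
  simpa only [hf, id_comp] using h

/-- The inclusion `Ω ^ l (X l) ⟶ (Θ^∞ X) 0`. -/
noncomputable def thetaι (X : SymSpectrum T) (l : ℕ) :
    (omPow T l).obj (X.obj l) ⟶ (Spectrum.thetaZero T).obj X.toSpectrum :=
  colimit.ι X.thetaSeq l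

lemma thetaι_w (X : SymSpectrum T) (l : ℕ) :
    (omPow T l).map (X.adjσ l) ≫ thetaι X (l + 1) = thetaι X l := by
  have h := colimit.w X.thetaSeq (homOfLE (Nat.le_add_right l 1))
  rw [Spectrum.thetaSeq_map] at h
  exact h

lemma cycleApp_thetaι (X : SymSpectrum T) (l : ℕ) :
    (omPow T l).map (X.adjσ l) ≫ cycleApp X (l + 1) ≫ thetaι X (l + 1 + 1) =
      cycleApp X l ≫ thetaι X (l + 1) := by
  rw [← assoc, cycleApp_comm, assoc, thetaι_w]

/-- The cycle operator `d_X : (Θ^∞ X) 0 ⟶ (Θ^∞ X) 0`, the map induced by `cycleApp` on the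
colimit. -/
noncomputable def cycle (X : SymSpectrum T) :
    (Spectrum.thetaZero T).obj X.toSpectrum ⟶ (Spectrum.thetaZero T).obj X.toSpectrum :=
  colimit.desc X.thetaSeq
    { pt := (Spectrum.thetaZero T).obj X.toSpectrum
      ι := NatTrans.ofSequence (fun l => cycleApp X l ≫ thetaι X (l + 1)) (fun l => by
        rw [Spectrum.thetaSeq_map]
        exact (cycleApp_thetaι X l).trans (comp_id _).symm) }

lemma thetaι_cycle (X : SymSpectrum T) (l : ℕ) :
    thetaι X l ≫ cycle X = cycleApp X l ≫ thetaι X (l + 1) :=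
  colimit.ι_desc _ _

end SymSpectrum

/-! ### Model structures -/

/-- Monoidal model categories: the pushout product axiom and the unit axiom hold. (The monoidal
structures below are symmetric, so the unit axiom is only stated on one side.) -/
class MonoidalModelCategory (D : Type u) [Category.{v} D] [MonoidalCategory D]
    [ModelCategory D] : Prop where
  pushoutProduct_cofibration {A B X Y : D} (i : A ⟶ B) (j : X ⟶ Y) [Cofibration i]
    [Cofibration j] :
    Cofibration ((Arrow.pushoutProduct.obj (Arrow.mk i)).obj (Arrow.mk j)).hom
  pushoutProduct_weakEquivalence_left {A B X Y : D} (i : A ⟶ B) (j : X ⟶ Y) [Cofibration i]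
    [WeakEquivalence i] [Cofibration j] :
    WeakEquivalence ((Arrow.pushoutProduct.obj (Arrow.mk i)).obj (Arrow.mk j)).hom
  pushoutProduct_weakEquivalence_right {A B X Y : D} (i : A ⟶ B) (j : X ⟶ Y) [Cofibration i]
    [Cofibration j] [WeakEquivalence j] :
    WeakEquivalence ((Arrow.pushoutProduct.obj (Arrow.mk i)).obj (Arrow.mk j)).hom
  unit {Q X : D} (q : Q ⟶ 𝟙_ D) [IsCofibrant Q] [WeakEquivalence q] [IsCofibrant X] :
    WeakEquivalence (q ▷ X)

variable [ModelCategory D]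

namespace Spectrum

/-- The level equivalences: the morphisms of spectra all of whose levels are weak equivalences. -/
def levelEquivalences : MorphismProperty (Spectrum T) :=
  fun _ _ f => ∀ n, WeakEquivalence (f.app n)

/-- The level fibrations: the morphisms of spectra all of whose levels are fibrations. -/
def levelFibrations : MorphismProperty (Spectrum T) :=
  fun _ _ f => ∀ n, Fibration (f.app n)

/-- The projective level model structure on spectra exists: the level equivalences and the level
fibrations are the weak equivalences and the fibrations of a model structure (whose cofibrations
are then determined by the lifting property). -/
def HasProjectiveLevelModelStructure : Prop :=
  ∃ M : ModelCategory (Spectrum T),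
    @weakEquivalences _ _ M.categoryWithWeakEquivalences = levelEquivalences T ∧
      @fibrations _ _ M.categoryWithFibrations = levelFibrations T

variable {T}

/-- A spectrum is level fibrant if all its levels are fibrant. -/
def LevelFibrant (X : Spectrum T) : Prop := ∀ n, IsFibrant (X.obj n)

/-- An `Ω`-spectrum: a level fibrant spectrum whose adjoint structure maps are weak
equivalences. -/
def IsOmegaSpectrum (X : Spectrum T) : Prop :=
  X.LevelFibrant ∧ ∀ n, WeakEquivalence (X.adjσ n)

/-- Stable equivalences: the maps `f : A ⟶ B` which induce bijections `[B, E] ⟶ [A, E]` for all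
`Ω`-spectra `E`, where `[-, -]` denotes morphisms in the level homotopy category, the
localization of the category of spectra at the level equivalences. -/
def IsStableEquivalence {A B : Spectrum T} (f : A ⟶ B) : Prop :=
  ∀ E : Spectrum T, E.IsOmegaSpectrum → Function.Bijective
    (fun g : (levelEquivalences T).Q.obj B ⟶ (levelEquivalences T).Q.obj E =>
      (levelEquivalences T).Q.map f ≫ g)

/-- A level fibrant replacement of a map `f : A ⟶ B`: a map `f'` between level fibrant spectra
with level equivalences from the source and the target of `f` to those of `f'`, compatible with
`f` and `f'`. -/
structure LevelFibrantReplacement {A B : Spectrum T} (f : A ⟶ B) where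
  A' : Spectrum T
  B' : Spectrum T
  f' : A' ⟶ B'
  a : A ⟶ A'
  b : B ⟶ B'
  comm : f ≫ b = a ≫ f'
  fibrant_source : A'.LevelFibrant
  fibrant_target : B'.LevelFibrant
  levelEquivalence_a : levelEquivalences T a
  levelEquivalence_b : levelEquivalences T b

/-- `Θ^∞ f` is a level equivalence. -/
def ThetaLevelEquivalence [HasColimitsOfShape ℕ D] {A B : Spectrum T} (f : A ⟶ B) : Prop :=
  ∀ n, WeakEquivalence ((theta T n).map f)

end Spectrum

end

end SymSp

open SymSp

/-! By (a), with a map between level fibrant spectra taken as its own replacement, such a map is a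
stable equivalence exactly when `Θ^∞` turns it into a level equivalence. As `T` is cofibrant, `Ω`
preserves fibrant objects, so all `R^k X` are level fibrant and this criterion applies to the maps
`R^k λ̃_X`. Three comparisons then carry the proof.

Moving the loop coordinate of `R X` to the outside gives a natural isomorphism `(Θ^∞ (R X))_0 ≅ (Θ^∞
X)_0` (`thetaRIso`), under which `Θ^∞ λ̃_X` becomes the cycle operator (`theta_lamT`). This yields 2
⇔ 3, and it shows that `Θ^∞ (R f)` is a level equivalence if and only if `Θ^∞ f` is.

Up to reversal of letters, the level `0` of the sequence `R^k X` is the sequence `Ω^k X_k`. Hence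
`(R^∞ X)_0 ≅ (Θ^∞ X)_0`, naturally in maps of symmetric spectra (`rInftyZeroHom`).

The maps `λ̃_{R X}` and `R λ̃_X` differ by an involution of `R (R X)`. As `Ω` commutes with
sequential colimits, `λ̃_{R^∞ X}` is therefore isomorphic to `R^∞ λ̃_X` (`lamT_RInfty`). So the
adjoint structure maps of `R^∞ X` are weak equivalences if and only if `R^∞ λ̃_X`, equivalently `Θ^∞
λ̃_X`, is a level equivalence; this is 2 ⇔ 4.

Level `n` is reduced to level `0` through `sh^n`, which commutes with `R` only up to permutations of
letters; `LamTCommutes` records this together with the compatibility with `λ̃`.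

Finally 1 ⇒ 2 is two-out-of-three in the naturality square of `λ̃`. Under 2 all `R^k λ̃_X` are
stable equivalences, so (b) makes `λ^∞_X` one, and 4 ⇒ 1 follows. -/

namespace SymSp

/-! ### The transposition of the first two letters -/

/-- The transposition of the first two of `n + 2` letters. -/
def swapFirst (n : ℕ) : Equiv.Perm (Fin (n + 2)) := Equiv.swap 0 1

lemma swapFirst_mul_self (n : ℕ) : swapFirst n * swapFirst n = 1 := Equiv.swap_mul_self _ _

lemma swapFirst_zero (n : ℕ) : swapFirst n 0 = 1 := Equiv.swap_apply_left _ _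

lemma swapFirst_one (n : ℕ) : swapFirst n (Fin.succ 0) = 0 := Equiv.swap_apply_right _ _

lemma swapFirst_succ_succ (n : ℕ) (i : Fin n) : swapFirst n i.succ.succ = i.succ.succ :=
  Equiv.swap_apply_of_ne_of_ne (Fin.succ_ne_zero _) (by simp [Fin.ext_iff])

/-- Structure maps turn the action of `τ` into that of `τ + 1`; this makes `shSwap` a map of
spectra. -/
lemma addOne_swapFirst (n : ℕ) : addOne (swapFirst n) = swapFirst (n + 1) := by
  refine Equiv.ext fun i => ?_
  induction i using Fin.lastCases with
  | last =>
    rw [addOne_last]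
    exact (swapFirst_succ_succ (n + 1) (Fin.last n)).symm
  | cast i =>
    rw [addOne_castSucc]
    simp only [swapFirst, Equiv.swap_apply_def, Fin.ext_iff]
    split_ifs <;> simp_all

lemma oneAdd_oneAdd_mul_swapFirst {n : ℕ} (τ : Equiv.Perm (Fin n)) :
    oneAdd (oneAdd τ) * swapFirst n = swapFirst n * oneAdd (oneAdd τ) := by
  refine Equiv.ext fun i => ?_
  simp only [Equiv.Perm.mul_apply]
  induction i using Fin.cases with
  | zero =>
    rw [swapFirst_zero, oneAdd_zero, swapFirst_zero, ← Fin.succ_zero_eq_one, oneAdd_succ,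
      oneAdd_zero]
  | succ i =>
    induction i using Fin.cases with
    | zero => rw [swapFirst_one, oneAdd_zero, oneAdd_succ, oneAdd_zero, swapFirst_one]
    | succ i =>
      rw [swapFirst_succ_succ, oneAdd_succ, oneAdd_succ, swapFirst_succ_succ]

/-- The permutation `χ_{n+1,1}` enters `sh (λ̃_X)` and `1 + χ_{n,1}` enters `λ̃_{sh X}`. They differ
only in whether the moved letter lands before or after the shifted letter. -/
lemma swapFirst_mul_chi (n : ℕ) : swapFirst n * chi (n + 1) = oneAdd (chi n) := by
  refine Equiv.ext fun i => ?_
  simp only [Equiv.Perm.mul_apply]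
  induction i using Fin.lastCases with
  | last => rw [chi_last, swapFirst_zero, ← Fin.succ_last, oneAdd_succ, chi_last]; rfl
  | cast i =>
    rw [chi_castSucc]
    induction i using Fin.cases with
    | zero => rw [swapFirst_one, Fin.castSucc_zero, oneAdd_zero]
    | succ i => rw [swapFirst_succ_succ, ← Fin.succ_castSucc, oneAdd_succ, chi_castSucc]

section

variable {D : Type u} [Category.{v} D] [MonoidalCategory D] [SymmetricCategory D]
  [MonoidalClosed D] (T : D)

/-! ### The interchange of two loop functors -/

/-- Taking adjoints twice turns identities between double loops into identities between the
interchanges `sw`. -/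
lemma hom_Om_Om_ext {A X : D} {f g : A ⟶ (Om T).obj ((Om T).obj X)}
    (h : f ▷ T ▷ T ≫ ev T _ ▷ T ≫ ev T X = g ▷ T ▷ T ≫ ev T _ ▷ T ≫ ev T X) : f = g := by
  apply SymSpectrum.hom_Om_ext
  apply SymSpectrum.hom_Om_ext
  simpa only [comp_whiskerRight, assoc] using h

/-- The interchange of the two loop coordinates of `Ω (Ω X)`. -/
def swapOm (X : D) : (Om T).obj ((Om T).obj X) ⟶ (Om T).obj ((Om T).obj X) :=
  adj T (adj T (sw T _ ≫ ev T _ ▷ T ≫ ev T X))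

lemma swapOm_ev (X : D) :
    swapOm T X ▷ T ▷ T ≫ ev T _ ▷ T ≫ ev T X = sw T _ ≫ ev T _ ▷ T ≫ ev T X := by
  rw [← comp_whiskerRight_assoc, swapOm, adj_ev, adj_ev]

lemma swapOm_swapOm (X : D) : swapOm T X ≫ swapOm T X = 𝟙 _ := by
  apply hom_Om_Om_ext T
  simp only [comp_whiskerRight, assoc]
  rw [swapOm_ev, ← assoc, sw_natural, assoc, swapOm_ev, ← assoc, sw_sw]
  simp

lemma Om_Om_map_ev {X Y : D} (h : X ⟶ Y) :
    (Om T).map ((Om T).map h) ▷ T ▷ T ≫ ev T _ ▷ T ≫ ev T Y = ev T _ ▷ T ≫ ev T X ≫ h := by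
  rw [← comp_whiskerRight_assoc, ev_natural, comp_whiskerRight, assoc, ev_natural]

lemma swapOm_natural {X Y : D} (h : X ⟶ Y) :
    (Om T).map ((Om T).map h) ≫ swapOm T Y = swapOm T X ≫ (Om T).map ((Om T).map h) := by
  apply hom_Om_Om_ext T
  simp only [comp_whiskerRight, assoc]
  rw [swapOm_ev, ← assoc, sw_natural, assoc, Om_Om_map_ev, ← assoc (ev T _ ▷ T),
    ← assoc (swapOm T X ▷ T ▷ T), swapOm_ev]
  simp only [assoc]

namespace SymSpectrum

variable {T}

lemma omσ_ev' {A B : D} (f : A ⊗ T ⟶ B) :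
    omσ f ▷ T ≫ ev T B = sw T _ ≫ ev T A ▷ T ≫ f := by
  rw [omσ, adj_ev]

/-- After all evaluations the new factor `T` has to pass both loop coordinates. Whether these are
interchanged before or after the passage does not matter, by the braid relation `sw_braid`. -/
lemma omσ_swapOm {A B : D} (f : A ⊗ T ⟶ B) :
    omσ (omσ f) ≫ swapOm T B = swapOm T A ▷ T ≫ omσ (omσ f) := by
  have key : omσ (omσ f) ▷ T ▷ T ≫ ev T _ ▷ T ≫ ev T B =
      sw T _ ▷ T ≫ sw T _ ≫ (ev T _ ▷ T ≫ ev T A) ▷ T ≫ f := by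
    rw [← comp_whiskerRight_assoc, omσ_ev', comp_whiskerRight, comp_whiskerRight, assoc, assoc,
      omσ_ev', ← assoc (ev T _ ▷ T ▷ T), sw_natural, assoc, comp_whiskerRight, assoc]
  have e := congrArg (fun k => k ▷ T ≫ f) (swapOm_ev T A)
  have b := congrArg (fun k => k ≫ ev T ((Om T).obj A) ▷ T ▷ T ≫ ev T A ▷ T ≫ f)
    (sw_braid T ((Om T).obj ((Om T).obj A)))
  have n := sw_natural T (swapOm T A)
  apply hom_Om_Om_ext T
  simp only [comp_whiskerRight, assoc] at key e b ⊢
  rw [swapOm_ev, ← assoc, sw_natural, assoc, key, ← b, ← assoc (swapOm T A ▷ T ▷ T ▷ T),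
    ← comp_whiskerRight, n, comp_whiskerRight, assoc, ← assoc (swapOm T A ▷ T ▷ T ▷ T),
    sw_natural, assoc, e]

/-! ### Functors commuting with `R` and with `λ̃` -/

variable (T)

/-- A functor `F` commutes with `λ̃` if there is a natural isomorphism `F (R X) ≅ R (F X)` under
which `F (λ̃_X)` corresponds to `λ̃_{F X}`. -/
structure LamTCommutes (F : SymSpectrum T ⥤ SymSpectrum T) where
  iso : R T ⋙ F ≅ F ⋙ R T
  map_lamT (X : SymSpectrum T) : F.map (lamT X) ≫ iso.hom.app X = lamT (F.obj X)

variable {T}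

lemma lamT_natural {X Y : SymSpectrum T} (f : X ⟶ Y) :
    lamT X ≫ (R T).map f = f ≫ lamT Y := by
  ext n
  refine (assoc _ _ _).trans ?_
  refine Eq.trans ?_ (assoc _ _ _)
  refine Eq.trans ?_ (congrArg (fun k => k ≫ _) (Spectrum.adjσ_natural f.toHom n))
  refine Eq.trans ?_ (assoc _ _ _).symm
  refine congrArg (fun k => X.adjσ n ≫ k) ?_
  exact ((Om T).map_comp _ _).symm.trans
    ((congrArg (Om T).map (f.equivariant (chi n))).trans ((Om T).map_comp _ _))

namespace LamTCommutes

variable (T) in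
/-- The identity functor commutes with `λ̃`. -/
def id : LamTCommutes T (𝟭 _) where
  iso := Iso.refl _
  map_lamT _ := comp_id _

/-- Functors commuting with `λ̃` are closed under composition. -/
def comp {F G : SymSpectrum T ⥤ SymSpectrum T} (hF : LamTCommutes T F) (hG : LamTCommutes T G) :
    LamTCommutes T (F ⋙ G) where
  iso := (Functor.associator _ _ _).symm ≪≫ Functor.isoWhiskerRight hF.iso G ≪≫
    Functor.associator _ _ _ ≪≫ Functor.isoWhiskerLeft F hG.iso ≪≫ (Functor.associator _ _ _).symm
  map_lamT X := by
    refine Eq.trans ?_ (hG.map_lamT (F.obj X))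
    rw [← hF.map_lamT, G.map_comp, assoc]
    simp

/-- The action of the transposition of the first two letters on `sh (sh X)`. -/
def shSwap (X : SymSpectrum T) : sh.obj (sh.obj X) ⟶ sh.obj (sh.obj X) where
  app n := X.act (swapFirst n)
  comm n := by
    rw [← addOne_swapFirst]
    exact (X.σ_act (swapFirst n)).symm
  equivariant {n} τ :=
    (X.act_mul _ _).symm.trans
      ((congrArg X.act (oneAdd_oneAdd_mul_swapFirst τ).symm).trans (X.act_mul _ _))

lemma shSwap_shSwap (X : SymSpectrum T) : shSwap X ≫ shSwap X = 𝟙 _ := by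
  ext n
  exact (X.act_mul _ _).symm.trans
    ((congrArg X.act (swapFirst_mul_self n)).trans (X.act_one _))

lemma shSwap_natural {X Y : SymSpectrum T} (f : X ⟶ Y) :
    sh.map (sh.map f) ≫ shSwap Y = shSwap X ≫ sh.map (sh.map f) := by
  ext n
  exact (f.equivariant (swapFirst n)).symm

variable (T) in
/-- The shift functor commutes with `λ̃`. -/
def sh : LamTCommutes T (SymSpectrum.sh (T := T)) where
  iso := NatIso.ofComponents (fun X =>
      { hom := omega.map (shSwap X)
        inv := omega.map (shSwap X)
        hom_inv_id := (omega.map_comp _ _).symm.trans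
          ((congrArg omega.map (shSwap_shSwap X)).trans (omega.map_id _))
        inv_hom_id := (omega.map_comp _ _).symm.trans
          ((congrArg omega.map (shSwap_shSwap X)).trans (omega.map_id _)) })
    (fun f => (omega.map_comp _ _).symm.trans
      ((congrArg omega.map (shSwap_natural f)).trans (omega.map_comp _ _)))
  map_lamT X := by
    ext n
    refine (assoc _ _ _).trans (congrArg (fun k => X.adjσ (n + 1) ≫ k) ?_)
    refine ((Om T).map_comp _ _).symm.trans (congrArg (Om T).map ?_)
    refine (X.act_mul _ _).symm.trans ?_
    rw [swapFirst_mul_chi]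
    rfl

/-- The interchange of the loop coordinates of `Ω (Ω X)`. -/
def omegaSwap (X : SymSpectrum T) : omega.obj (omega.obj X) ⟶ omega.obj (omega.obj X) where
  app n := swapOm T (X.obj n)
  comm _ := omσ_swapOm _
  equivariant _ := swapOm_natural T _

lemma omegaSwap_omegaSwap (X : SymSpectrum T) : omegaSwap X ≫ omegaSwap X = 𝟙 _ := by
  ext n
  exact swapOm_swapOm T _

lemma omegaSwap_natural {X Y : SymSpectrum T} (f : X ⟶ Y) :
    omega.map (omega.map f) ≫ omegaSwap Y = omegaSwap X ≫ omega.map (omega.map f) := by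
  ext n
  exact swapOm_natural T _

variable (T) in
/-- The loop functor commutes with `λ̃`. -/
def omega : LamTCommutes T (SymSpectrum.omega (T := T)) where
  iso := NatIso.ofComponents (fun X =>
      { hom := omegaSwap (SymSpectrum.sh.obj X)
        inv := omegaSwap (SymSpectrum.sh.obj X)
        hom_inv_id := omegaSwap_omegaSwap _
        inv_hom_id := omegaSwap_omegaSwap _ })
    (fun f => omegaSwap_natural _)
  map_lamT X := by
    ext n
    -- The common value: the given loop is evaluated at the second factor `T`, and the first factor
    -- is fed into the structure map.
    refine hom_Om_Om_ext T (Eq.trans (b := sw T _ ≫ ev T _ ▷ T ≫ X.σ n ≫ X.act (chi n)) ?_ ?_)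
    · have h : ((Om T).map (lamTApp X n) ≫ swapOm T _) ▷ T ▷ T ≫ ev T _ ▷ T ≫ ev T _ =
          sw T _ ≫ ev T _ ▷ T ≫ X.σ n ≫ X.act (chi n) := by
        simp only [comp_whiskerRight, assoc]
        rw [swapOm_ev, ← assoc, sw_natural, assoc, ← comp_whiskerRight_assoc, ev_natural,
          comp_whiskerRight, assoc, lamTApp_ev]
      exact h
    · have h := congrArg (fun k => k ▷ T ≫ ev T _)
        (lamTApp_ev (SymSpectrum.omega.obj X) n)
      refine Eq.trans ?_ (h.symm.trans ?_)
      · have h' : (omσ (X.σ n) ≫ (Om T).map (X.act (chi n))) ▷ T ≫ ev T _ =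
            sw T _ ≫ ev T _ ▷ T ≫ X.σ n ≫ X.act (chi n) := by
          rw [comp_whiskerRight, assoc, ev_natural, omσ_ev]
        exact h'.symm
      · exact (congrArg (fun k => k ≫ _) (comp_whiskerRight _ _ T)).trans (assoc _ _ _)

variable (T) in
/-- The functor `R` commutes with `λ̃`. -/
def R : LamTCommutes T (SymSpectrum.R T) := (sh T).comp (omega T)

/-- The isomorphism is the product of two commuting involutions, on the shifted letters and on the
loop coordinates. Being its own inverse, it exchanges `λ̃_{R X}` and `R λ̃_X` in both directions. -/
lemma R_iso_hom_app_hom_app (X : SymSpectrum T) :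
    (R T).iso.hom.app X ≫ (R T).iso.hom.app X = 𝟙 _ := by
  have h : (R T).iso.hom.app X =
      SymSpectrum.omega.map (SymSpectrum.omega.map (shSwap X)) ≫ omegaSwap _ := by
    simp only [R, comp, Iso.trans_hom, Iso.symm_hom, NatTrans.comp_app,
      Functor.associator_inv_app, Functor.associator_hom_app, Functor.isoWhiskerRight_hom,
      Functor.isoWhiskerLeft_hom, Functor.whiskerRight_app, Functor.whiskerLeft_app]
    refine (id_comp _).trans (Eq.trans ?_ rfl)
    refine congrArg (fun k => _ ≫ k) ((id_comp _).trans (comp_id _))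
  have e : omegaSwap _ ≫ SymSpectrum.omega.map (SymSpectrum.omega.map (shSwap X)) =
      SymSpectrum.omega.map (SymSpectrum.omega.map (shSwap X)) ≫ omegaSwap _ :=
    (omegaSwap_natural (shSwap X)).symm
  have e' : SymSpectrum.omega.map (SymSpectrum.omega.map (shSwap X)) ≫
      SymSpectrum.omega.map (SymSpectrum.omega.map (shSwap X)) = 𝟙 _ := by
    rw [← Functor.map_comp, ← Functor.map_comp, shSwap_shSwap, CategoryTheory.Functor.map_id, CategoryTheory.Functor.map_id]
  rw [h]
  refine (assoc _ _ _).trans ?_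
  refine (congrArg (fun k => _ ≫ k) ((assoc _ _ _).symm.trans
    (congrArg (fun k => k ≫ _) e))).trans ?_
  refine (congrArg (fun k => _ ≫ k) ((assoc _ _ _).trans
    (congrArg (fun k => _ ≫ k) (omegaSwap_omegaSwap _)))).trans ?_
  exact (congrArg (fun k => _ ≫ k) (comp_id _)).trans e'

lemma lamT_R_iso (X : SymSpectrum T) :
    lamT ((SymSpectrum.R T).obj X) ≫ (R T).iso.hom.app X = (SymSpectrum.R T).map (lamT X) := by
  rw [← (R T).map_lamT, assoc, R_iso_hom_app_hom_app]
  exact comp_id _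

variable (T) in
/-- The iterated shift functors commute with `λ̃`. -/
def shPow : ∀ n : ℕ, LamTCommutes T (SymSpectrum.shPow T n)
  | 0 => id T
  | n + 1 => (sh T).comp (shPow n)

end LamTCommutes

end SymSpectrum
end
end SymSp

namespace SymSp
section

variable {D : Type u} [Category.{v} D] [MonoidalCategory D] [SymmetricCategory D]
  [MonoidalClosed D] {T : D}

/-! ### Levelwise colimits -/

namespace Spectrum

variable (T) in
/-- The evaluation of spectra at level `n`. -/
def eval (n : ℕ) : Spectrum T ⥤ D where
  obj X := X.obj n
  map f := f.app n

/-- A cocone of spectra which is levelwise a colimit is a colimit. -/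
def isColimitOfEval {J : Type*} [Category J] {F : J ⥤ Spectrum T} {c : Cocone F}
    (hc : ∀ n, IsColimit ((eval T n).mapCocone c)) : IsColimit c where
  desc s :=
    { app := fun n => (hc n).desc ((eval T n).mapCocone s)
      comm := fun n => by
        -- After transposition to maps into `Ω`, the colimit property at level `n` itself suffices,
        -- with no colimit cocone on smash products with `T`.
        apply (adj T).injective
        refine (hc n).hom_ext fun j => ?_
        have h1 : (c.ι.app j).app (n + 1) ≫ (hc (n + 1)).desc ((eval T (n + 1)).mapCocone s) =
            (s.ι.app j).app (n + 1) := (hc (n + 1)).fac ((eval T (n + 1)).mapCocone s) j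
        have h2 : (c.ι.app j).app n ≫ (hc n).desc ((eval T n).mapCocone s) =
            (s.ι.app j).app n := (hc n).fac ((eval T n).mapCocone s) j
        refine (adj_comp_left T ((c.ι.app j).app n) _).symm.trans
          ((congrArg (adj T) ?_).trans (adj_comp_left T ((c.ι.app j).app n) _))
        refine (assoc _ _ _).symm.trans
          ((congrArg (fun k => k ≫ _) ((c.ι.app j).comm n).symm).trans ?_)
        refine (assoc _ _ _).trans ((congrArg (fun k => _ ≫ k) h1).trans ?_)
        refine ((s.ι.app j).comm n).trans ?_
        refine (congrArg (fun k => k ▷ T ≫ _) h2).symm.trans ?_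
        exact (congrArg (fun k => k ≫ _) (comp_whiskerRight _ _ T)).trans (assoc _ _ _) }
  fac s j := by
    ext n
    exact (hc n).fac ((eval T n).mapCocone s) j
  uniq s m h := by
    ext n
    refine (hc n).uniq ((eval T n).mapCocone s) (m.app n) fun j => ?_
    exact congrArg (fun k => Hom.app k n) (h j)

end Spectrum

namespace SymSpectrum

lemma isIso_of_eval {X Y : SymSpectrum T} (f : X ⟶ Y) (h : ∀ n, IsIso (f.app n)) : IsIso f := by
  refine ⟨⟨{ app := fun n => inv (f.app n), comm := fun n => ?_, equivariant := fun τ => ?_ },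
    ?_, ?_⟩⟩
  · rw [IsIso.comp_inv_eq, assoc, f.comm, ← comp_whiskerRight_assoc, IsIso.inv_hom_id,
      id_whiskerRight, id_comp]
  · rw [IsIso.comp_inv_eq, assoc, f.equivariant, IsIso.inv_hom_id_assoc]
  · ext n
    exact IsIso.hom_inv_id (f.app n)
  · ext n
    exact IsIso.inv_hom_id (f.app n)

lemma eval_jointlyReflectIsomorphisms : JointlyReflectIsomorphisms (eval T) where
  isIso f h := isIso_of_eval f h

section

variable {J : Type*} [Category J] [HasColimitsOfShape J D]

instance (F : J ⥤ SymSpectrum T) (n : ℕ) : PreservesColimit F (eval T n) :=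
  preservesColimit_of_preserves_colimit_cocone (colimCoconeIsColimit F)
    (IsColimit.ofIsoColimit (colimit.isColimit (F ⋙ eval T n)) (Cocone.ext (Iso.refl _) fun _ => comp_id _))

instance : PreservesColimitsOfShape J (sh (T := T)) where
  preservesColimit :=
    { preserves := fun hc =>
        ⟨eval_jointlyReflectIsomorphisms.jointlyReflectsColimit fun n =>
          isColimitOfPreserves (eval T (n + 1)) hc⟩ }

instance (n : ℕ) : PreservesColimitsOfShape J (shPow T n) := by
  induction n with
  | zero => exact inferInstanceAs (PreservesColimitsOfShape J (𝟭 _))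
  | succ n _ => exact inferInstanceAs (PreservesColimitsOfShape J (sh ⋙ shPow T n))

/-- Evaluations preserve colimits and jointly reflect isomorphisms, so the claim reduces to `D`,
where for sequential colimits it is assumption (c). -/
instance [PreservesColimitsOfShape J (ihom T)] :
    PreservesColimitsOfShape J (omega (T := T)) where
  preservesColimit :=
    { preserves := fun hc =>
        ⟨eval_jointlyReflectIsomorphisms.jointlyReflectsColimit fun n =>
          isColimitOfPreserves (ihom T) (isColimitOfPreserves (eval T n) hc)⟩ }

instance [PreservesColimitsOfShape J (ihom T)] : PreservesColimitsOfShape J (R T) :=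
  inferInstanceAs (PreservesColimitsOfShape J (sh ⋙ omega))

instance : PreservesColimitsOfShape J (forget T) where
  preservesColimit :=
    { preserves := fun hc =>
        ⟨Spectrum.isColimitOfEval fun n => isColimitOfPreserves (eval T n) hc⟩ }

end

/-! ### Functoriality of `R^∞` -/

lemma RSeq_map (X : SymSpectrum T) (k : ℕ) :
    X.RSeq.map (homOfLE (Nat.le_add_right k 1)) = (RPow T k).map (lamT X) :=
  Functor.ofSequence_map_homOfLE_succ _ _

/-- The map of sequences `R ^ k X ⟶ R ^ k Y` induced by a map `X ⟶ Y`. -/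
def RSeqMap {X Y : SymSpectrum T} (f : X ⟶ Y) : X.RSeq ⟶ Y.RSeq :=
  NatTrans.ofSequence (fun k => (RPow T k).map f) fun k => by
    rw [RSeq_map, RSeq_map]
    exact ((RPow T k).map_comp _ _).symm.trans
      ((congrArg (RPow T k).map (lamT_natural f)).trans ((RPow T k).map_comp _ _))

variable [HasColimitsOfShape ℕ D]

/-- The inclusion of `R ^ k X` into `R^∞ X`. -/
noncomputable def RInftyι (X : SymSpectrum T) (k : ℕ) : (RPow T k).obj X ⟶ X.RInfty :=
  colimit.ι X.RSeq k

lemma RInfty_hom_ext {X Y : SymSpectrum T} {f g : X.RInfty ⟶ Y}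
    (h : ∀ k, RInftyι X k ≫ f = RInftyι X k ≫ g) : f = g :=
  colimit.hom_ext h

/-- The map `R^∞ X ⟶ R^∞ Y` induced by a map `X ⟶ Y`. -/
noncomputable def RInftyMap {X Y : SymSpectrum T} (f : X ⟶ Y) : X.RInfty ⟶ Y.RInfty :=
  colimMap (RSeqMap f)

lemma RInftyι_map {X Y : SymSpectrum T} (f : X ⟶ Y) (k : ℕ) :
    RInftyι X k ≫ RInftyMap f = (RPow T k).map f ≫ RInftyι Y k :=
  ι_colimMap _ _

/-! ### Commutation of functors with `R^∞` -/

namespace LamTCommutes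

variable {F : SymSpectrum T ⥤ SymSpectrum T} (hF : LamTCommutes T F)

/-- A functor commuting with `λ̃` commutes with `R ^ k`. -/
def rPowIso : ∀ (k : ℕ) (X : SymSpectrum T),
    F.obj ((RPow T k).obj X) ≅ (RPow T k).obj (F.obj X)
  | 0, _ => Iso.refl _
  | k + 1, X => rPowIso k ((SymSpectrum.R T).obj X) ≪≫ (RPow T k).mapIso (hF.iso.app X)

lemma rPowIso_natural (k : ℕ) {X Y : SymSpectrum T} (f : X ⟶ Y) :
    F.map ((RPow T k).map f) ≫ (hF.rPowIso k Y).hom =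
      (hF.rPowIso k X).hom ≫ (RPow T k).map (F.map f) := by
  induction k generalizing X Y with
  | zero => exact (comp_id _).trans (id_comp _).symm
  | succ k ih =>
    refine (assoc _ _ _).symm.trans ?_
    refine (congrArg (fun g => g ≫ _) (ih ((SymSpectrum.R T).map f))).trans ?_
    refine (assoc _ _ _).trans (Eq.trans (congrArg (fun g => _ ≫ g) ?_) (assoc _ _ _).symm)
    exact ((RPow T k).map_comp _ _).symm.trans
      ((congrArg (RPow T k).map (hF.iso.hom.naturality f)).trans ((RPow T k).map_comp _ _))

/-- Naturality leaves `R^k` applied to `map_lamT`. The isomorphisms thus respect the transition maps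
and pass to the colimit. -/
lemma rPowIso_succ (k : ℕ) (X : SymSpectrum T) :
    F.map ((RPow T k).map (lamT X)) ≫ (hF.rPowIso (k + 1) X).hom =
      (hF.rPowIso k X).hom ≫ (RPow T k).map (lamT (F.obj X)) := by
  refine (assoc _ _ _).symm.trans ?_
  refine (congrArg (fun g => g ≫ _) (hF.rPowIso_natural k (lamT X))).trans ?_
  refine (assoc _ _ _).trans (congrArg (fun g => _ ≫ g) ?_)
  exact ((RPow T k).map_comp _ _).symm.trans (congrArg (RPow T k).map (hF.map_lamT X))

/-- The comparison of the sequences `F (R ^ k X)` and `R ^ k (F X)`. -/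
def seqHom (X : SymSpectrum T) : X.RSeq ⋙ F ⟶ (F.obj X).RSeq :=
  NatTrans.ofSequence (fun k => (hF.rPowIso k X).hom) fun k => by
    rw [Functor.comp_map, RSeq_map, RSeq_map]
    exact hF.rPowIso_succ k X

instance (X : SymSpectrum T) : IsIso (hF.seqHom X) := by
  have : ∀ k, IsIso ((hF.seqHom X).app k) := fun k =>
    inferInstanceAs (IsIso (hF.rPowIso k X).hom)
  exact NatIso.isIso_of_isIso_app _

variable [PreservesColimitsOfShape ℕ F]

/-- The comparison map `F (R^∞ X) ⟶ R^∞ (F X)`. -/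
noncomputable def rInftyHom (X : SymSpectrum T) : F.obj X.RInfty ⟶ (F.obj X).RInfty :=
  (preservesColimitIso F X.RSeq).hom ≫ colimMap (hF.seqHom X)

instance (X : SymSpectrum T) : IsIso (hF.rInftyHom X) := by
  have : IsIso (colimMap (hF.seqHom X)) := inferInstanceAs (IsIso (colim.map (hF.seqHom X)))
  exact IsIso.comp_isIso' (Iso.isIso_hom _) this

lemma map_RInftyι_rInftyHom (X : SymSpectrum T) (k : ℕ) :
    F.map (RInftyι X k) ≫ hF.rInftyHom X = (hF.rPowIso k X).hom ≫ RInftyι (F.obj X) k :=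
  (assoc _ _ _).symm.trans ((congrArg (fun g => g ≫ _)
    (ι_preservesColimitIso_hom F X.RSeq k)).trans (ι_colimMap _ _))

lemma rInftyHom_natural {X Y : SymSpectrum T} (f : X ⟶ Y) :
    F.map (RInftyMap f) ≫ hF.rInftyHom Y = hF.rInftyHom X ≫ RInftyMap (F.map f) := by
  refine (isColimitOfPreserves F (colimit.isColimit X.RSeq)).hom_ext fun k => ?_
  change F.map (RInftyι X k) ≫ _ = F.map (RInftyι X k) ≫ _
  rw [← F.map_comp_assoc, RInftyι_map, F.map_comp, assoc, map_RInftyι_rInftyHom, ← assoc,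
    rPowIso_natural, ← assoc (F.map _), map_RInftyι_rInftyHom, assoc, assoc, RInftyι_map]

end LamTCommutes

/-- The map `λ̃` is carried past the `k` copies of `R` one at a time, each passage being
`lamT_R_iso`. -/
lemma lamT_rPowIso (k : ℕ) (X : SymSpectrum T) :
    lamT ((RPow T k).obj X) ≫ ((LamTCommutes.R T).rPowIso k X).hom = (RPow T k).map (lamT X) := by
  induction k generalizing X with
  | zero => exact comp_id _
  | succ k ih =>
    refine (assoc _ _ _).symm.trans ((congrArg (fun g => g ≫ _) (ih _)).trans ?_)
    exact ((RPow T k).map_comp _ _).symm.trans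
      (congrArg (RPow T k).map (LamTCommutes.lamT_R_iso X))

/-- Naturality of `λ̃` reduces the claim on the `k`-th stage to `lamT_rPowIso`. -/
lemma lamT_RInfty [PreservesColimitsOfShape ℕ (ihom T)] (X : SymSpectrum T) :
    lamT X.RInfty ≫ (LamTCommutes.R T).rInftyHom X = RInftyMap (lamT X) := by
  refine RInfty_hom_ext fun k => ?_
  rw [← assoc, ← lamT_natural, assoc, LamTCommutes.map_RInftyι_rInftyHom, ← assoc, lamT_rPowIso,
    RInftyι_map]

/-! ### The level `0` of `R^∞ X` -/

/-- The permutation reversing the order of `k` letters. -/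
def revPerm : ∀ k : ℕ, Equiv.Perm (Fin k)
  | 0 => 1
  | k + 1 => addOne (revPerm k) * (chi k)⁻¹

lemma revPerm_mul_chi (k : ℕ) : revPerm (k + 1) * chi k = addOne (revPerm k) := by
  rw [revPerm, inv_mul_cancel_right]

/-- The levels of `R ^ k X`: at level `0`, it is `Ω ^ k (X k)`. -/
def rPowZeroIso : ∀ (k : ℕ) (X : SymSpectrum T),
    ((RPow T k).obj X).obj 0 ≅ (omPow T k).obj (X.obj k)
  | 0, _ => Iso.refl _
  | k + 1, X => rPowZeroIso k ((R T).obj X)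

lemma rPowZeroIso_natural (k : ℕ) {X Y : SymSpectrum T} (f : X ⟶ Y) :
    ((RPow T k).map f).app 0 ≫ (rPowZeroIso k Y).hom =
      (rPowZeroIso k X).hom ≫ (omPow T k).map (f.app k) := by
  induction k generalizing X Y with
  | zero => exact (comp_id _).trans (id_comp _).symm
  | succ k ih => exact ih ((R T).map f)

/-- The action of a permutation as an isomorphism. -/
def actIso (X : SymSpectrum T) {n : ℕ} (τ : Equiv.Perm (Fin n)) : X.obj n ≅ X.obj n where
  hom := X.act τ
  inv := X.act τ⁻¹
  hom_inv_id := by rw [← X.act_mul, inv_mul_cancel, X.act_one]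
  inv_hom_id := by rw [← X.act_mul, mul_inv_cancel, X.act_one]

/-- The reversals absorb the factor `χ_{k,1}` by which `λ̃` differs from the adjoint structure map:
what remains is `revPerm k + 1`, which passes through the structure map. -/
lemma lamTApp_revPerm (X : SymSpectrum T) (k : ℕ) :
    lamTApp X k ≫ (Om T).map (X.act (revPerm (k + 1))) = X.act (revPerm k) ≫ X.adjσ k := by
  rw [lamTApp, assoc, ← Functor.map_comp, ← X.act_mul, revPerm_mul_chi, Spectrum.adjσ,
    ← adj_comp_right, ← X.σ_act, adj_comp_left]

/-- The isomorphism `(R ^ k X) 0 ≅ Ω ^ k (X k)` which is compatible with the maps of the sequences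
defining `R^∞ X` and `Θ^∞ X`. -/
def rSeqZeroIso (k : ℕ) (X : SymSpectrum T) :
    ((RPow T k).obj X).obj 0 ≅ (omPow T k).obj (X.obj k) :=
  rPowZeroIso k X ≪≫ (omPow T k).mapIso (X.actIso (revPerm k))

lemma rSeqZeroIso_natural (k : ℕ) {X Y : SymSpectrum T} (f : X ⟶ Y) :
    ((RPow T k).map f).app 0 ≫ (rSeqZeroIso k Y).hom =
      (rSeqZeroIso k X).hom ≫ (omPow T k).map (f.app k) := by
  refine (assoc _ _ _).symm.trans ((congrArg (fun g => g ≫ _) (rPowZeroIso_natural k f)).trans ?_)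
  refine (assoc _ _ _).trans (Eq.trans (congrArg (fun g => _ ≫ g) ?_) (assoc _ _ _).symm)
  exact ((omPow T k).map_comp _ _).symm.trans
    ((congrArg (omPow T k).map (f.equivariant (revPerm k)).symm).trans ((omPow T k).map_comp _ _))

lemma rSeqZeroIso_succ (k : ℕ) (X : SymSpectrum T) :
    ((RPow T k).map (lamT X)).app 0 ≫ (rSeqZeroIso (k + 1) X).hom =
      (rSeqZeroIso k X).hom ≫ (omPow T k).map (X.adjσ k) := by
  refine (assoc _ _ _).symm.trans
    ((congrArg (fun g => g ≫ _) (rPowZeroIso_natural k (lamT X))).trans ?_)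
  refine (assoc _ _ _).trans (Eq.trans (congrArg (fun g => _ ≫ g) ?_) (assoc _ _ _).symm)
  exact ((omPow T k).map_comp _ _).symm.trans
    ((congrArg (omPow T k).map (lamTApp_revPerm X k)).trans ((omPow T k).map_comp _ _))

/-- The comparison of the sequences `(R ^ k X) 0` and `Ω ^ k (X k)`. -/
def rSeqZeroHom (X : SymSpectrum T) : X.RSeq ⋙ eval T 0 ⟶ X.thetaSeq :=
  NatTrans.ofSequence (fun k => (rSeqZeroIso k X).hom) fun k => by
    rw [Functor.comp_map, RSeq_map, Spectrum.thetaSeq_map]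
    exact rSeqZeroIso_succ k X

instance (X : SymSpectrum T) : IsIso (rSeqZeroHom X) := by
  have : ∀ k, IsIso ((rSeqZeroHom X).app k) := fun k =>
    inferInstanceAs (IsIso (rSeqZeroIso k X).hom)
  exact NatIso.isIso_of_isIso_app _

/-- The comparison map `(R^∞ X) 0 ⟶ (Θ^∞ X) 0`. -/
noncomputable def rInftyZeroHom (X : SymSpectrum T) :
    X.RInfty.obj 0 ⟶ (Spectrum.thetaZero T).obj X.toSpectrum :=
  (preservesColimitIso (eval T 0) X.RSeq).hom ≫ colimMap (rSeqZeroHom X)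

instance isIso_rInftyZeroHom (X : SymSpectrum T) : IsIso (rInftyZeroHom X) := by
  have : IsIso (colimMap (rSeqZeroHom X)) := inferInstanceAs (IsIso (colim.map (rSeqZeroHom X)))
  exact IsIso.comp_isIso' (Iso.isIso_hom _) this

lemma RInftyι_app_rInftyZeroHom (X : SymSpectrum T) (k : ℕ) :
    (RInftyι X k).app 0 ≫ rInftyZeroHom X = (rSeqZeroIso k X).hom ≫ thetaι X k :=
  (assoc _ _ _).symm.trans ((congrArg (fun g => g ≫ _)
    (ι_preservesColimitIso_hom (eval T 0) X.RSeq k)).trans (ι_colimMap _ _))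

lemma thetaι_map {X Y : SymSpectrum T} (f : X ⟶ Y) (l : ℕ) :
    thetaι X l ≫ (Spectrum.thetaZero T).map f.toHom =
      (omPow T l).map (f.app l) ≫ thetaι Y l :=
  ι_colimMap _ _

lemma rInftyZeroHom_natural {X Y : SymSpectrum T} (f : X ⟶ Y) :
    (RInftyMap f).app 0 ≫ rInftyZeroHom Y =
      rInftyZeroHom X ≫ (Spectrum.thetaZero T).map f.toHom := by
  refine (isColimitOfPreserves (eval T 0) (colimit.isColimit X.RSeq)).hom_ext fun k => ?_
  change (RInftyι X k).app 0 ≫ _ = (RInftyι X k).app 0 ≫ _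
  rw [← assoc, ← comp_app, RInftyι_map, comp_app, assoc, RInftyι_app_rInftyZeroHom, ← assoc,
    rSeqZeroIso_natural, assoc, ← assoc ((RInftyι X k).app 0), RInftyι_app_rInftyZeroHom, assoc,
    thetaι_map]

end SymSpectrum
end
end SymSp

namespace SymSp
section

variable {D : Type u} [Category.{v} D] [MonoidalCategory D] [SymmetricCategory D]
  [MonoidalClosed D] {T : D}

/-! ### Permutations of loop coordinates -/

lemma omPrecomp_id (n : ℕ) (X : D) : omPrecomp T n (𝟙 _) X = 𝟙 _ := by
  rw [omPrecomp, whiskerLeft_id, id_comp, iterEv, Equiv.apply_symm_apply]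

lemma omPrecomp_omPrecomp (n : ℕ) (h h' : tPow T n ⟶ tPow T n) (X : D) :
    omPrecomp T n h X ≫ omPrecomp T n h' X = omPrecomp T n (h' ≫ h) X := by
  conv_lhs => enter [1]; rw [omPrecomp]
  rw [iterAdj_omPrecomp, omPrecomp, whiskerLeft_comp, assoc]

lemma omPrecomp_natural (n : ℕ) (h : tPow T n ⟶ tPow T n) {X Y : D} (g : X ⟶ Y) :
    (omPow T n).map g ≫ omPrecomp T n h Y = omPrecomp T n h X ≫ (omPow T n).map g := by
  have e : (omPow T n).map g = iterAdj T n (iterEv T n X ≫ g) := by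
    rw [iterAdj_comp_right, iterEv, Equiv.apply_symm_apply, id_comp]
  conv_lhs => rw [e]
  rw [iterAdj_omPrecomp, omPrecomp, ← iterAdj_comp_right, assoc]

/-- The isomorphism `Ω ^ (n + 1) X ≅ Ω ^ (1 + n) X` moving the innermost loop coordinate to the
outside. -/
def rotOm (n : ℕ) (X : D) : (omPow T (n + 1)).obj X ≅ (omPow T (n + 1)).obj X where
  hom := omPrecomp T (n + 1) (chiT T n).inv X
  inv := omPrecomp T (n + 1) (chiT T n).hom X
  hom_inv_id := by rw [omPrecomp_omPrecomp, Iso.hom_inv_id, omPrecomp_id]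
  inv_hom_id := by rw [omPrecomp_omPrecomp, Iso.inv_hom_id, omPrecomp_id]

namespace SymSpectrum

variable [HasColimitsOfShape ℕ D]

/-- The isomorphism `Ω ^ l (R X) l ≅ Ω ^ (l + 1) (X (l + 1))` moving the loop coordinate of `R X` to
the outside. -/
def rotR (X : SymSpectrum T) (l : ℕ) :
    (omPow T l).obj (((R T).obj X).obj l) ≅ (omPow T (l + 1)).obj (X.obj (l + 1)) :=
  rotOm l (X.obj (l + 1))

/-- The adjoint form of `rotR_adjσ`. The structure map of a loop spectrum interchanges the new
factor `T` with the loop coordinate; the inverse of `χ_{l+1,1}` contains the same interchange, and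
the two cancel. -/
lemma iterAdj_omσ (X : SymSpectrum T) (l : ℕ) {A : D} (f : A ⊗ tPow T (l + 1) ⟶ X.obj (l + 1)) :
    iterAdj T (l + 1) ((α_ A (tPow T l) T).inv ≫ adj T ((α_ A (tPow T l) T).hom ≫ f) ▷ T ≫
        omσ (X.σ (l + 1))) ≫ omPrecomp T (l + 2) (chiT T (l + 1)).inv (X.obj (l + 2)) =
      (iterAdj T (l + 1) f ≫ omPrecomp T (l + 1) (chiT T l).inv (X.obj (l + 1))) ≫
        (omPow T (l + 1)).map (X.adjσ (l + 1)) := by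
  have h : (α_ A (tPow T l) T).inv ≫ adj T ((α_ A (tPow T l) T).hom ≫ f) ▷ T ≫
      omσ (X.σ (l + 1)) = adj T ((α_ A (tPow T l) T).inv ▷ T ≫ sw T _ ≫
        (α_ A (tPow T l) T).hom ▷ T ≫ f ▷ T ≫ X.σ (l + 1)) := by
    rw [omσ, ← adj_comp_left, ← adj_comp_left, ← assoc (_ ▷ T ▷ T), sw_natural, assoc,
      ← comp_whiskerRight_assoc (adj T _ ▷ T), adj_ev, comp_whiskerRight, assoc]
  rw [h, iterAdj_omPrecomp, iterAdj_adjσ]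
  erw [iterAdj_succ T (l + 1), iterAdj_omPrecomp]
  congr 1
  rw [chiT_succ_inv, whiskerLeft_comp, assoc, sw_tensor]
  simp

lemma rotR_adjσ (X : SymSpectrum T) (l : ℕ) :
    (omPow T l).map (((R T).obj X).adjσ l) ≫ (rotR X (l + 1)).hom =
      (rotR X l).hom ≫ (omPow T (l + 1)).map (X.adjσ (l + 1)) := by
  -- Here `f` is the iterated evaluation, the universal case of the preceding identity.
  obtain ⟨f, hf⟩ := (iterAdj T (l + 1)).surjective (𝟙 ((omPow T (l + 1)).obj (X.obj (l + 1))))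
  have h := iterAdj_omσ X l f
  rw [hf, id_comp] at h
  refine Eq.trans ?_ h
  refine Eq.trans ?_ (congrArg (fun k => k ≫ _)
    (iterAdj_adjσ ((R T).obj X) l (adj T ((α_ _ (tPow T l) T).hom ≫ f))))
  have e : iterAdj T l (adj T ((α_ _ (tPow T l) T).hom ≫ f)) = 𝟙 _ :=
    (iterAdj_succ_apply T l f).symm.trans hf
  exact ((congrArg (fun k => (k ≫ (omPow T l).map (((R T).obj X).adjσ l)) ≫ _) e).trans
    (congrArg (fun k => k ≫ _) (id_comp _))).symm

lemma rotR_natural {X Y : SymSpectrum T} (f : X ⟶ Y) (l : ℕ) :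
    (omPow T l).map (((R T).map f).app l) ≫ (rotR Y l).hom =
      (rotR X l).hom ≫ (omPow T (l + 1)).map (f.app (l + 1)) :=
  omPrecomp_natural (l + 1) (chiT T l).inv (f.app (l + 1))

/-- The factor `χ_{l,1}` in `λ̃` acts on `X (l + 1)` and the rotation acts on the loop coordinates;
together they are the conjugation in the cycle operator. -/
lemma lamT_rotR (X : SymSpectrum T) (l : ℕ) :
    (omPow T l).map ((lamT X).app l) ≫ (rotR X l).hom = cycleApp X l := by
  have h1 : (omPow T l).map (lamTApp X l) =
      (omPow T l).map (X.adjσ l) ≫ (omPow T (l + 1)).map (X.act (chi l)) :=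
    (omPow T l).map_comp _ _
  refine (congrArg (fun k => k ≫ _) h1).trans ((assoc _ _ _).trans
    (congrArg (fun k => _ ≫ k) ?_))
  exact omPrecomp_natural (l + 1) _ _

/-! ### The comparison of `Θ^∞ (R X)` and `Θ^∞ X` -/

lemma theta_hom_ext {X : SymSpectrum T} {Y : D}
    {f g : (Spectrum.thetaZero T).obj X.toSpectrum ⟶ Y}
    (h : ∀ l, thetaι X l ≫ f = thetaι X l ≫ g) : f = g :=
  colimit.hom_ext h

/-- Maps out of `(Θ^∞ X) 0`. -/
noncomputable def thetaDesc (X : SymSpectrum T) {Y : D}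
    (g : ∀ l, (omPow T l).obj (X.obj l) ⟶ Y)
    (hg : ∀ l, (omPow T l).map (X.adjσ l) ≫ g (l + 1) = g l) :
    (Spectrum.thetaZero T).obj X.toSpectrum ⟶ Y :=
  colimit.desc X.thetaSeq
    { pt := Y
      ι := NatTrans.ofSequence g fun l => by
        rw [Spectrum.thetaSeq_map]
        exact (hg l).trans (comp_id _).symm }

lemma thetaι_desc (X : SymSpectrum T) {Y : D}
    (g : ∀ l, (omPow T l).obj (X.obj l) ⟶ Y)
    (hg : ∀ l, (omPow T l).map (X.adjσ l) ≫ g (l + 1) = g l) (l : ℕ) :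
    thetaι X l ≫ thetaDesc X g hg = g l :=
  colimit.ι_desc _ _

/-- The isomorphism `(Θ^∞ (R X)) 0 ≅ (Θ^∞ X) 0` given by moving the loop coordinate of `R X` to
the outside. -/
noncomputable def thetaRIso (X : SymSpectrum T) :
    (Spectrum.thetaZero T).obj ((R T).obj X).toSpectrum ≅
      (Spectrum.thetaZero T).obj X.toSpectrum where
  hom := thetaDesc _ (fun l => (rotR X l).hom ≫ thetaι X (l + 1)) fun l => by
    rw [← assoc, rotR_adjσ, assoc, thetaι_w]
  -- The inverse rotation needs at least one loop coordinate, so the index is first raised from `l`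
  -- to `l + 1`.
  inv := thetaDesc _ (fun l => (omPow T l).map (X.adjσ l) ≫ (rotR X l).inv ≫
      thetaι ((R T).obj X) l) fun l => by
    have h : (omPow T (l + 1)).map (X.adjσ (l + 1)) ≫ (rotR X (l + 1)).inv =
        (rotR X l).inv ≫ (omPow T l).map (((R T).obj X).adjσ l) := by
      rw [Iso.comp_inv_eq, assoc, rotR_adjσ, Iso.inv_hom_id_assoc]
    refine congrArg (fun k => _ ≫ k) ?_
    rw [← assoc, h, assoc, thetaι_w]
  hom_inv_id := theta_hom_ext fun l => by
    rw [← assoc, thetaι_desc, assoc, thetaι_desc, comp_id, ← assoc, ← rotR_adjσ, assoc,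
      Iso.hom_inv_id_assoc, thetaι_w]
  inv_hom_id := theta_hom_ext fun l => by
    rw [← assoc, thetaι_desc, assoc, assoc, thetaι_desc, Iso.inv_hom_id_assoc, thetaι_w, comp_id]

lemma thetaι_thetaRIso_hom (X : SymSpectrum T) (l : ℕ) :
    thetaι ((R T).obj X) l ≫ (thetaRIso X).hom = (rotR X l).hom ≫ thetaι X (l + 1) :=
  colimit.ι_desc _ _

lemma thetaRIso_natural {X Y : SymSpectrum T} (f : X ⟶ Y) :
    (Spectrum.thetaZero T).map ((R T).map f).toHom ≫ (thetaRIso Y).hom =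
      (thetaRIso X).hom ≫ (Spectrum.thetaZero T).map f.toHom := by
  refine theta_hom_ext fun l => ?_
  rw [← assoc, thetaι_map, assoc, thetaι_thetaRIso_hom, ← assoc, rotR_natural,
    ← assoc (thetaι _ l), thetaι_thetaRIso_hom, assoc, assoc, thetaι_map]

lemma theta_lamT (X : SymSpectrum T) :
    (Spectrum.thetaZero T).map (lamT X).toHom ≫ (thetaRIso X).hom = cycle X := by
  refine theta_hom_ext fun l => ?_
  rw [← assoc, thetaι_map, assoc, thetaι_thetaRIso_hom, thetaι_cycle, ← assoc, lamT_rotR]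

end SymSpectrum
end
end SymSp

namespace SymSp
section

variable {D : Type u} [Category.{v} D] [MonoidalCategory D] [SymmetricCategory D]
  [MonoidalClosed D] {T : D}

/-! ### Loops of fibrant objects -/

/-- Smashing with an object is a left adjoint, so source and target are both initial. -/
lemma isIso_initial_whiskerLeft [HasInitial D] {A B : D} (i : A ⟶ B) : IsIso ((⊥_ D) ◁ i) := by
  have h (A : D) : IsInitial ((⊥_ D) ⊗ A) :=
    (IsInitial.isInitialObj (tensorLeft A) _ initialIsInitial).ofIso (β_ A (⊥_ D))
  exact ⟨(h B).to _, (h A).hom_ext _ _, (h B).hom_ext _ _⟩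

variable [ModelCategory D]

section

variable [MonoidalModelCategory D]

variable (T) in
-- Up to isomorphism, `T ◁ i` is the pushout product of `i` with the map from the initial object to
-- `T`.
lemma trivialCofibration_whiskerLeft [IsCofibrant T] {A B : D} (i : A ⟶ B) [Cofibration i]
    [WeakEquivalence i] : Cofibration (T ◁ i) ∧ WeakEquivalence (T ◁ i) := by
  let sq := Functor.PushoutObjObj.ofHasPushout (curriedTensor D) (initial.to T) i
  have h1 : Cofibration sq.ι :=
    MonoidalModelCategory.pushoutProduct_cofibration (initial.to T) i
  have h2 : WeakEquivalence sq.ι :=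
    MonoidalModelCategory.pushoutProduct_weakEquivalence_right (initial.to T) i
  have : IsIso (((curriedTensor D).obj (⊥_ D)).map i) := isIso_initial_whiskerLeft i
  have : IsIso sq.inl := sq.isPushout.isIso_inl_of_isIso
  have h : sq.inl ≫ sq.ι = T ◁ i := sq.inl_ι
  rw [← h]
  exact ⟨inferInstance, inferInstance⟩

variable (T) in
lemma isFibrant_Om [IsCofibrant T] (Y : D) [IsFibrant Y] : IsFibrant ((Om T).obj Y) := by
  rw [isFibrant_iff_of_isTerminal ((Om T).map (terminal.from Y))
    (IsTerminal.isTerminalObj (Om T) _ terminalIsTerminal), fibration_iff,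
    ← trivialCofibrations_rlp]
  intro A B i hi
  rw [← (ihom.adjunction T).hasLiftingProperty_iff]
  have := (cofibration_iff i).2 hi.1
  have := (weakEquivalence_iff i).2 hi.2
  obtain ⟨h1, h2⟩ := trivialCofibration_whiskerLeft T i
  exact ModelCategory.cm4a (T ◁ i) (terminal.from Y)

end

/-! ### Weak equivalences in commutative squares -/

lemma weakEquivalence_iff_of_isIso {A B A' B' : D} {f : A ⟶ B} {g : A' ⟶ B'} {a : A ⟶ A'}
    {b : B ⟶ B'} (ha : IsIso a) (hb : IsIso b) (h : f ≫ b = a ≫ g) :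
    WeakEquivalence f ↔ WeakEquivalence g := by
  rw [← weakEquivalence_postcomp_iff f b, h, weakEquivalence_precomp_iff]

lemma isFibrant_of_iso {A B : D} (e : A ≅ B) [IsFibrant B] : IsFibrant A :=
  isFibrant_of_fibration e.hom

/-! ### Weak equivalences on levels, on `Θ^∞` and on `R^∞` -/

namespace SymSpectrum

lemma weakEquivalence_shPow_app_zero {X Y : SymSpectrum T} (f : X ⟶ Y) (n : ℕ) :
    WeakEquivalence (((shPow T n).map f).app 0) ↔ WeakEquivalence (f.app n) := by
  have h (m : ℕ) : WeakEquivalence (((shPow T n).map f).app m) ↔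
      WeakEquivalence (f.app (m + n)) := by
    induction n generalizing X Y with
    | zero => exact Iff.rfl
    | succ n ih => exact ih (sh.map f)
  -- Level `0` of `sh^n X` is level `0 + n` of `X`, which is not definitionally level `n`.
  have e : ∀ m, m = n → (WeakEquivalence (((shPow T n).map f).app 0) ↔
      WeakEquivalence (f.app m)) → (WeakEquivalence (((shPow T n).map f).app 0) ↔
      WeakEquivalence (f.app n)) := by
    rintro _ rfl h
    exact h
  exact e (0 + n) (Nat.zero_add n) (h 0)

/-- Since `χ_{n,1}` acts invertibly, a level fibrant `X` is an `Ω`-spectrum if and only if `λ̃_X` is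
a level equivalence. -/
lemma weakEquivalence_lamT_app (X : SymSpectrum T) (n : ℕ) :
    WeakEquivalence ((lamT X).app n) ↔ WeakEquivalence (X.adjσ n) := by
  have : IsIso ((Om T).map (X.act (chi n))) :=
    inferInstanceAs (IsIso ((Om T).map (X.actIso (chi n)).hom))
  exact weakEquivalence_postcomp_iff (X.adjσ n) ((Om T).map (X.act (chi n)))

lemma levelFibrant_R [MonoidalModelCategory D] [IsCofibrant T] {X : SymSpectrum T}
    (hX : X.toSpectrum.LevelFibrant) : ((R T).obj X).toSpectrum.LevelFibrant := fun n =>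
  have := hX (n + 1)
  isFibrant_Om T (X.obj (n + 1))

lemma levelFibrant_RPow [MonoidalModelCategory D] [IsCofibrant T] {X : SymSpectrum T}
    (hX : X.toSpectrum.LevelFibrant) (k : ℕ) :
    ((RPow T k).obj X).toSpectrum.LevelFibrant := by
  induction k generalizing X with
  | zero => exact hX
  | succ k ih => exact ih (levelFibrant_R hX)

variable [HasColimitsOfShape ℕ D]

lemma levelFibrant_RInfty [MonoidalModelCategory D] [IsCofibrant T]
    (hd : ∀ F : ℕ ⥤ D, (∀ k, IsFibrant (F.obj k)) → IsFibrant (colimit F))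
    {X : SymSpectrum T} (hX : X.toSpectrum.LevelFibrant) :
    X.RInfty.toSpectrum.LevelFibrant := fun n =>
  have := hd (X.RSeq ⋙ eval T n) fun k => levelFibrant_RPow hX k n
  isFibrant_of_iso (preservesColimitIso (eval T n) X.RSeq)

lemma weakEquivalence_theta_iff {X Y : SymSpectrum T} (f : X ⟶ Y) (n : ℕ) :
    WeakEquivalence ((Spectrum.theta T n).map ((forget T).map f)) ↔
      WeakEquivalence ((Spectrum.thetaZero T).map ((forget T).map ((shPow T n).map f))) := by
  induction n generalizing X Y with
  | zero => exact Iff.rfl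
  | succ n ih => exact ih (sh.map f)

/-- Level `n` follows from `thetaRIso` for `sh^n X`, once `sh^n` has been moved past `R`. -/
lemma weakEquivalence_theta_R {X Y : SymSpectrum T} (f : X ⟶ Y) (n : ℕ) :
    WeakEquivalence ((Spectrum.theta T n).map ((forget T).map ((R T).map f))) ↔
      WeakEquivalence ((Spectrum.theta T n).map ((forget T).map f)) := by
  rw [weakEquivalence_theta_iff, weakEquivalence_theta_iff]
  refine Iff.trans ?_ (weakEquivalence_iff_of_isIso (Iso.isIso_hom _)
    (Iso.isIso_hom _) (thetaRIso_natural ((shPow T n).map f)))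
  have h := congrArg (forget T ⋙ Spectrum.thetaZero T).map
    ((LamTCommutes.shPow T n).iso.hom.naturality f)
  rw [Functor.map_comp, Functor.map_comp] at h
  exact weakEquivalence_iff_of_isIso
    (Functor.map_isIso (forget T ⋙ Spectrum.thetaZero T) ((LamTCommutes.shPow T n).iso.hom.app X))
    (Functor.map_isIso (forget T ⋙ Spectrum.thetaZero T) ((LamTCommutes.shPow T n).iso.hom.app Y))
    h

lemma weakEquivalence_theta_RPow {X Y : SymSpectrum T} (f : X ⟶ Y) (k n : ℕ) :
    WeakEquivalence ((Spectrum.theta T n).map ((forget T).map ((RPow T k).map f))) ↔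
      WeakEquivalence ((Spectrum.theta T n).map ((forget T).map f)) := by
  induction k generalizing X Y with
  | zero => exact Iff.rfl
  | succ k ih => exact (ih ((R T).map f)).trans (weakEquivalence_theta_R f n)

lemma weakEquivalence_theta_lamT (X : SymSpectrum T) (n : ℕ) :
    WeakEquivalence ((Spectrum.theta T n).map ((forget T).map (lamT X))) ↔
      WeakEquivalence (cycle ((shPow T n).obj X)) := by
  have h := congrArg (forget T ⋙ Spectrum.thetaZero T).map
    ((LamTCommutes.shPow T n).map_lamT X)
  rw [Functor.map_comp] at h
  rw [weakEquivalence_theta_iff, ← theta_lamT, weakEquivalence_postcomp_iff]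
  exact weakEquivalence_iff_of_isIso
    (Functor.map_isIso (forget T ⋙ Spectrum.thetaZero T) (𝟙 ((shPow T n).obj X)))
    (Functor.map_isIso (forget T ⋙ Spectrum.thetaZero T) ((LamTCommutes.shPow T n).iso.hom.app X))
    (h.trans ((id_comp _).symm.trans (congrArg (fun k => k ≫ _)
      ((forget T ⋙ Spectrum.thetaZero T).map_id _).symm)))

/-- Natural isomorphisms `(R^∞ X)_n ≅ (R^∞ (sh^n X))_0 ≅ (Θ^∞ (sh^n X))_0` connect the two maps. -/
lemma weakEquivalence_RInftyMap_app {X Y : SymSpectrum T} (f : X ⟶ Y) (n : ℕ) :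
    WeakEquivalence ((RInftyMap f).app n) ↔
      WeakEquivalence ((Spectrum.theta T n).map ((forget T).map f)) := by
  rw [weakEquivalence_theta_iff, ← weakEquivalence_shPow_app_zero]
  refine Iff.trans ?_ (weakEquivalence_iff_of_isIso
    (isIso_rInftyZeroHom _) (isIso_rInftyZeroHom _) (rInftyZeroHom_natural ((shPow T n).map f)))
  have h := congrArg (eval T 0).map ((LamTCommutes.shPow T n).rInftyHom_natural f)
  rw [Functor.map_comp, Functor.map_comp] at h
  exact weakEquivalence_iff_of_isIso
    (Functor.map_isIso (eval T 0) ((LamTCommutes.shPow T n).rInftyHom X))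
    (Functor.map_isIso (eval T 0) ((LamTCommutes.shPow T n).rInftyHom Y)) h

lemma weakEquivalence_adjσ_RInfty [PreservesColimitsOfShape ℕ (ihom T)] (X : SymSpectrum T)
    (n : ℕ) : WeakEquivalence (X.RInfty.adjσ n) ↔
      WeakEquivalence ((Spectrum.theta T n).map ((forget T).map (lamT X))) := by
  rw [← weakEquivalence_lamT_app, ← weakEquivalence_RInftyMap_app, ← lamT_RInfty]
  have : IsIso (((LamTCommutes.R T).rInftyHom X).app n) :=
    inferInstanceAs (IsIso ((eval T n).map ((LamTCommutes.R T).rInftyHom X)))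
  exact (weakEquivalence_postcomp_iff _ _).symm

end SymSpectrum

/-! ### Level equivalences and trivial fibrant replacements -/

namespace Spectrum

lemma IsStableEquivalence.of_levelEquivalence {A B : Spectrum T} (f : A ⟶ B)
    (hf : levelEquivalences T f) : IsStableEquivalence f := fun _ _ => by
  have := Localization.inverts (levelEquivalences T).Q (levelEquivalences T) f hf
  exact (asIso ((levelEquivalences T).Q.map f)).homFromEquiv.symm.bijective

/-- A map between level fibrant spectra as its own level fibrant replacement. -/
def LevelFibrantReplacement.self {A B : Spectrum T} (f : A ⟶ B) (hA : A.LevelFibrant)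
    (hB : B.LevelFibrant) : LevelFibrantReplacement f where
  A' := A
  B' := B
  f' := f
  a := 𝟙 A
  b := 𝟙 B
  comm := by rw [id_comp, comp_id]
  fibrant_source := hA
  fibrant_target := hB
  levelEquivalence_a _ := inferInstanceAs (WeakEquivalence (𝟙 _))
  levelEquivalence_b _ := inferInstanceAs (WeakEquivalence (𝟙 _))

end Spectrum

end

end SymSp

/-! ### The equivalence of the four conditions -/

theorem theorem2p10 {D : Type u} [Category.{v} D] [MonoidalCategory D] [SymmetricCategory D]
    [MonoidalClosed D] [ModelCategory D] [MonoidalModelCategory D] [HasColimitsOfShape ℕ D]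
    (T : D) [IsCofibrant T]
    (hlevel : Spectrum.HasProjectiveLevelModelStructure T)
    (ha : ∀ {A B : Spectrum T} (f : A ⟶ B),
      [Spectrum.IsStableEquivalence f,
        ∀ r : Spectrum.LevelFibrantReplacement f, Spectrum.ThetaLevelEquivalence r.f',
        ∃ r : Spectrum.LevelFibrantReplacement f, Spectrum.ThetaLevelEquivalence r.f'].TFAE)
    (hb : ∀ (F : ℕ ⥤ Spectrum T) (c : Cocone F) (_ : IsColimit c),
      (∀ k, (F.obj k).LevelFibrant) →
      (∀ k, Spectrum.IsStableEquivalence (F.map (homOfLE (Nat.le_add_right k 1)))) →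
      Spectrum.IsStableEquivalence (c.ι.app 0))
    (hc : PreservesColimitsOfShape ℕ (ihom T))
    (hd : ∀ F : ℕ ⥤ D, (∀ k, IsFibrant (F.obj k)) → IsFibrant (colimit F))
    (X : SymSpectrum T) (hX : X.toSpectrum.LevelFibrant) :
    [∃ (Y : SymSpectrum T) (f : X ⟶ Y), Y.toSpectrum.IsOmegaSpectrum ∧
        Spectrum.IsStableEquivalence ((SymSpectrum.forget T).map f),
      Spectrum.IsStableEquivalence ((SymSpectrum.forget T).map (SymSpectrum.lamT X)),
      ∀ n : ℕ, WeakEquivalence (SymSpectrum.cycle ((SymSpectrum.shPow T n).obj X)),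
      (SymSpectrum.RInfty X).toSpectrum.IsOmegaSpectrum].TFAE ∧
    ((SymSpectrum.RInfty X).toSpectrum.IsOmegaSpectrum →
      Spectrum.IsStableEquivalence ((SymSpectrum.forget T).map (SymSpectrum.lamInfty X))) := by
  have hfib : ∀ {A B : Spectrum T} (f : A ⟶ B), A.LevelFibrant → B.LevelFibrant →
      (Spectrum.IsStableEquivalence f ↔ Spectrum.ThetaLevelEquivalence f) := fun f hA hB =>
    ⟨fun h => ((ha f).out 0 1 rfl rfl).1 h (.self f hA hB),
      fun h => ((ha f).out 2 0 rfl rfl).1 ⟨.self f hA hB, h⟩⟩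
  have hRX := SymSpectrum.levelFibrant_R hX
  have hlam := hfib ((SymSpectrum.forget T).map (SymSpectrum.lamT X)) hX hRX
  have h23 : Spectrum.IsStableEquivalence ((SymSpectrum.forget T).map (SymSpectrum.lamT X)) ↔
      ∀ n : ℕ, WeakEquivalence (SymSpectrum.cycle ((SymSpectrum.shPow T n).obj X)) :=
    hlam.trans (forall_congr' fun n => SymSpectrum.weakEquivalence_theta_lamT X n)
  have h24 : Spectrum.IsStableEquivalence ((SymSpectrum.forget T).map (SymSpectrum.lamT X)) ↔
      (SymSpectrum.RInfty X).toSpectrum.IsOmegaSpectrum :=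
    hlam.trans ((forall_congr' fun n =>
      (SymSpectrum.weakEquivalence_adjσ_RInfty X n).symm).trans
        -- Assumption (d) makes `R^∞ X` level fibrant, so only its adjoint structure maps matter.
        (and_iff_right (SymSpectrum.levelFibrant_RInfty hd hX)).symm)
  have h2 (h : Spectrum.IsStableEquivalence ((SymSpectrum.forget T).map (SymSpectrum.lamT X))) :
      Spectrum.IsStableEquivalence ((SymSpectrum.forget T).map (SymSpectrum.lamInfty X)) := by
    refine hb (X.RSeq ⋙ SymSpectrum.forget T) _
      (isColimitOfPreserves (SymSpectrum.forget T) (colimit.isColimit X.RSeq))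
      (fun k => SymSpectrum.levelFibrant_RPow hX k) fun k => ?_
    rw [Functor.comp_map, SymSpectrum.RSeq_map]
    -- Applying `R^k` does not change whether `Θ^∞` of a map is a level equivalence, so every `R^k
    -- λ̃_X` inherits the property from `λ̃_X`.
    exact (hfib _ (SymSpectrum.levelFibrant_RPow hX k)
      (SymSpectrum.levelFibrant_RPow hX (k + 1))).2 fun n =>
        (SymSpectrum.weakEquivalence_theta_RPow (SymSpectrum.lamT X) k n).2 (hlam.1 h n)
  have h12 : (∃ (Y : SymSpectrum T) (f : X ⟶ Y), Y.toSpectrum.IsOmegaSpectrum ∧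
      Spectrum.IsStableEquivalence ((SymSpectrum.forget T).map f)) →
      Spectrum.IsStableEquivalence ((SymSpectrum.forget T).map (SymSpectrum.lamT X)) := by
    rintro ⟨Y, f, hY, hf⟩
    have hYlam : Spectrum.IsStableEquivalence
        ((SymSpectrum.forget T).map (SymSpectrum.lamT Y)) :=
      .of_levelEquivalence _ fun n => (SymSpectrum.weakEquivalence_lamT_app Y n).2 (hY.2 n)
    refine hlam.2 fun n => ?_
    have h1 := (hfib _ hX hY.1).1 hf n
    have h2 := (hfib _ hY.1 (SymSpectrum.levelFibrant_R hY.1)).1 hYlam n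
    have h3 := (SymSpectrum.weakEquivalence_theta_R f n).2 h1
    have e := congrArg (SymSpectrum.forget T ⋙ Spectrum.theta T n).map
      (SymSpectrum.lamT_natural f)
    rw [Functor.map_comp, Functor.map_comp] at e
    -- Two-out-of-three in `λ̃_X ≫ R f = f ≫ λ̃_Y` after `Θ^∞`; the other three sides are weak
    -- equivalences.
    exact (weakEquivalence_iff _).2 (MorphismProperty.of_postcomp _ _ _ h3.mem
      (e ▸ (weakEquivalences D).comp_mem _ _ h1.mem h2.mem))
  refine ⟨?_, fun h => h2 (h24.2 h)⟩
  tfae_have 1 → 2 := h12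
  tfae_have 2 ↔ 3 := h23
  tfae_have 2 ↔ 4 := h24
  tfae_have 4 → 1 := fun h => ⟨_, SymSpectrum.lamInfty X, h, h2 (h24.2 h)⟩
  tfae_finish
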